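/- Let $\alpha>-1$ and let $d\mu_\alpha(x)=x^{2\alpha+1}\,dx$ on $\mathbb R_+=(0,\infty)$. Let $J_\alpha$ be the Bessel function of the first kind, $\psi^\alpha_\lambda(x)=\sqrt{x\lambda}\,J_\alpha(x\lambda)$ and $\Psi^\alpha_\lambda(x)=(x\lambda)^{-\alpha}J_\alpha(x\lambda)$ for $x,\lambda>0$. The modified Hankel transform of $f\in L^2(\mu_\alpha)$ is $$h_\alpha f(\lambda)=\int_0^\infty \Psi^\alpha_\lambda(x)f(x)\,d\mu_\alpha(x),$$ understood as the limit in $L^2(\mu_\alpha)$, as $R\to\infty$, of the integrals over $(0,R]$. The Bessel heat semigroup on $L^2(\mu_\alpha)$ is defined by $$T^{\alpha,\Psi}_tf=h_\alpha\big(e^{-t(\cdot)^2}h_\alpha f\big),\qquad t\ge 0,\ f\in L^2(\mu_\alpha),$$ and it is extended to $L^1(\mu_\alpha)+L^\infty(\mu_\alpha)$ by $T^{\alpha,\Psi}_0=\mathrm{Id}$ and, for $t>0$, $$T^{\alpha,\Psi}_tf(x)=\int_0^\infty G^{\alpha,\Psi}_t(x,y)f(y)\,d\mu_\alpha(y),\qquad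 G^{\alpha,\Psi}_t(x,y)=(xy)^{-(\alpha+1/2)}\int_0^\infty e^{-t\lambda^2}\psi^\alpha_\lambda(x)\psi^\alpha_\lambda(y)\,d\lambda,\qquad x,y>0.$$ Then these objects are well defined (the limit defining $h_\alpha f$ exists for every $f\in L^2(\mu_\alpha)$; the integral defining $T^{\alpha,\Psi}_tf(x)$ converges absolutely for all $t>0$, $x>0$, $f\in L^1(\mu_\alpha)+L^\infty(\mu_\alpha)$; and both definitions of $T^{\alpha,\Psi}_t$ agree on $L^2(\mu_\alpha)$ for every $t\ge0$), and $\{T^{\alpha,\Psi}_t\}_{t\ge 0}$ is a Markovian symmetric diffusion semigroup. This means that the $T_t=T^{\alpha,\Psi}_t$ are linear operators from $L^1(\mu_\alpha)+L^\infty(\mu_\alpha)$ to the measurable functions modulo equality almost everywhere, with $T_0=\mathrm{Id}$, such that (i) for each $1\le p\le\infty$, every $T_t$ is a contraction on $L^p(\mu_\alpha)$, and $T_{s+t}=T_sT_t$ there for all $s,t\ge 0$; (ii) each $T_t$ is self-adjoint on $L^2(\mu_\alpha)$; (iii) $\lim_{t\to0^+}T_tf=f$ in $L^2(\mu_\alpha)$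 for each $f\in L^2(\mu_\alpha)$; (iv) $T_tf\ge0$ whenever $f\ge0$, for each $f\in L^1(\mu_\alpha)+L^\infty(\mu_\alpha)$ and each $t\ge0$; (v) $T_t\mathbf 1=\mathbf 1$ for all $t\ge0$. The functions may be real- or complex-valued. -/

import Mathlib

open MeasureTheory Filter Set
open scoped Topology NNReal ENNReal ComplexOrder

noncomputable section

section Abstract

variable {X : Type*} [MeasurableSpace X] {𝕜 : Type*} [RCLike 𝕜]

/-- Membership of a function in `L¹(μ) + L^∞(μ)`. -/
def MemL1AddLinf (μ : Measure X) (f : X → 𝕜) : Prop :=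
  ∃ g h : X → 𝕜, MemLp g 1 μ ∧ MemLp h ∞ μ ∧ f =ᵐ[μ] g + h

/-- `T` is a symmetric diffusion semigroup on the `σ`-finite measure space `(X, μ)`, acting on
`𝒟 = L¹(μ) + L^∞(μ)`.  Elements of function spaces are represented by functions, and all
identities are understood almost everywhere; `congr_ae` says that `T t` acts on classes of
functions modulo equality almost everywhere. -/
structure IsSymmetricDiffusionSemigroup (μ : Measure X) [SigmaFinite μ]
    (T : ℝ≥0 → (X → 𝕜) → (X → 𝕜)) : Prop where
  congr_ae : ∀ t f g, MemL1AddLinf μ f → f =ᵐ[μ] g → T t f =ᵐ[μ] T t g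
  /-- `T t` maps `𝒟` to measurable functions. -/
  aestronglyMeasurable : ∀ t f, MemL1AddLinf μ f → AEStronglyMeasurable (T t f) μ
  map_add : ∀ t f g, MemL1AddLinf μ f → MemL1AddLinf μ g →
    T t (f + g) =ᵐ[μ] T t f + T t g
  map_smul : ∀ t (c : 𝕜) f, MemL1AddLinf μ f → T t (c • f) =ᵐ[μ] c • T t f
  map_zero_time : ∀ f, MemL1AddLinf μ f → T 0 f =ᵐ[μ] f
  /-- Each `T t` is a contraction on `L^p`, `1 ≤ p ≤ ∞`. -/
  contraction : ∀ t (p : ℝ≥0∞), 1 ≤ p → ∀ f, MemLp f p μ →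
    MemLp (T t f) p μ ∧ eLpNorm (T t f) p μ ≤ eLpNorm f p μ
  /-- The semigroup law on `L^p`, `1 ≤ p ≤ ∞`. -/
  semigroup : ∀ s t (p : ℝ≥0∞), 1 ≤ p → ∀ f, MemLp f p μ → T (s + t) f =ᵐ[μ] T s (T t f)
  /-- Each `T t` (everywhere defined and bounded on `L²` by `contraction`) is self-adjoint. -/
  selfAdjoint : ∀ t f g, MemLp f 2 μ → MemLp g 2 μ →
    ∫ x, inner 𝕜 (T t f x) (g x) ∂μ = ∫ x, inner 𝕜 (f x) (T t g x) ∂μ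
  /-- Strong continuity at `0` in `L²`. -/
  tendsto_zero : ∀ f, MemLp f 2 μ →
    Tendsto (fun t : ℝ≥0 => eLpNorm (T t f - f) 2 μ) (𝓝[>] 0) (𝓝 0)

/-- A Markovian symmetric diffusion semigroup: positive and conservative. -/
structure IsMarkovianSymmetricDiffusionSemigroup (μ : Measure X) [SigmaFinite μ]
    (T : ℝ≥0 → (X → 𝕜) → (X → 𝕜)) : Prop extends IsSymmetricDiffusionSemigroup μ T where
  nonneg : ∀ t f, MemL1AddLinf μ f → 0 ≤ᵐ[μ] f → 0 ≤ᵐ[μ] T t f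
  conservative : ∀ t, T t (fun _ => 1) =ᵐ[μ] fun _ => 1

end Abstract

/-- The Bessel function of the first kind `J_ν(z)`, `z > 0`. -/
def besselJ (ν z : ℝ) : ℝ :=
  (z / 2) ^ ν * ∑' k : ℕ, (-1) ^ k / (k.factorial * Real.Gamma (k + ν + 1)) * (z / 2) ^ (2 * k)

/-- The measure `dμ_α(x) = x^{2α+1} dx` on the half-line `(0, ∞)`. -/
def besselMeasure (α : ℝ) : Measure ℝ :=
  (volume.restrict (Ioi 0)).withDensity fun x => ENNReal.ofReal (x ^ (2 * α + 1))

instance besselMeasure_sigmaFinite (α : ℝ) : SigmaFinite (besselMeasure α) := by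
  unfold besselMeasure
  infer_instance

/-- `Ψ^α_l(x) = (x l)^{-α} J_α(x l)`. -/
def besselPsi (α l x : ℝ) : ℝ := (x * l) ^ (-α) * besselJ α (x * l)

/-- `ψ^α_l(x) = √(x l) J_α(x l)`. -/
def besselPsi0 (α l x : ℝ) : ℝ := √(x * l) * besselJ α (x * l)

/-- The heat kernel `G^{α,ψ}_t(x, y) = ∫₀^∞ e^{-t l²} ψ^α_l(x) ψ^α_l(y) dl`. -/
def besselKernel0 (α t x y : ℝ) : ℝ :=
  ∫ l in Ioi (0 : ℝ), Real.exp (-t * l ^ 2) * besselPsi0 α l x * besselPsi0 α l y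

/-- The heat kernel `G^{α,Ψ}_t(x, y) = (x y)^{-(α+1/2)} G^{α,ψ}_t(x, y)`. -/
def besselKernel (α t x y : ℝ) : ℝ := (x * y) ^ (-(α + 1 / 2)) * besselKernel0 α t x y

section Operators

variable {𝕜 : Type*} [RCLike 𝕜]

/-- The truncated modified Hankel transform `∫₀^R Ψ^α_l(x) f(x) dμ_α(x)`. -/
def modHankelTrunc (α R : ℝ) (f : ℝ → 𝕜) (l : ℝ) : 𝕜 :=
  ∫ x in Ioc 0 R, besselPsi α l x • f x ∂(besselMeasure α)

/-- `g` is the modified Hankel transform of `f ∈ L²(μ_α)`: the `L²(μ_α)`-limit as `R → ∞` of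
the truncated integrals. -/
def IsModHankel (α : ℝ) (f g : ℝ → 𝕜) : Prop :=
  MemLp g 2 (besselMeasure α) ∧
    Tendsto (fun R => eLpNorm (modHankelTrunc α R f - g) 2 (besselMeasure α)) atTop (𝓝 0)

open Classical in
/-- The modified Hankel transform `h_α` on `L²(μ_α)` (determined up to a null set). -/
def modHankel (α : ℝ) (f : ℝ → 𝕜) : ℝ → 𝕜 :=
  if h : ∃ g, IsModHankel α f g then h.choose else 0

/-- The semigroup on `L²(μ_α)`, defined spectrally: `h_α (e^{-t l²} h_α f)`. -/
def besselHeatL2 (α : ℝ) (t : ℝ≥0) (f : ℝ → 𝕜) : ℝ → 𝕜 :=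
  modHankel α fun l => Real.exp (-t * l ^ 2) • modHankel α f l

/-- The semigroup on `L¹(μ_α) + L^∞(μ_α)`, given by the heat kernel for `t > 0` and the
identity for `t = 0`. -/
def besselHeat (α : ℝ) (t : ℝ≥0) (f : ℝ → 𝕜) : ℝ → 𝕜 :=
  if t = 0 then f else fun x => ∫ y, besselKernel α t x y • f y ∂(besselMeasure α)

end Operators

end

/-!
The Gaussians `x ↦ exp (-a x²)` reduce everything to explicit integrals. By uniqueness of the
Laplace transform in the variable `x²`, a function on `(0, ∞)` is determined almost everywhere by
its integrals against Gaussians with large `a`; in particular Gaussians span a dense subspace of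
`L²(μ_α)`.

Weber's first exponential integral says that integration against `Ψ^α` sends `exp (-a x²)` to
`(2a)^(-α-1) exp (-l² / (4a))`. This map preserves the Gram matrix of the Gaussians and squares to
the identity, so it extends to an isometric involution of `L²(μ_α)`. Fubini's theorem and the
uniqueness principle identify it with the integral transform on truncated functions, hence with
`h_α`. The same argument computes the heat kernel in closed form (Weber's second exponential
integral), in terms of the modified Bessel function `I_α`.

The closed form is positive and symmetric, has total mass `1`, and sends `exp (-a x²)` to
`(1 + 4at)^(-α-1) exp (-a x² / (1 + 4at))`. Jensen's inequality gives the contraction on every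
`L^p`. Comparing actions on Gaussians yields the Chapman–Kolmogorov identity and the agreement
with the spectral definition, from which strong continuity follows by dominated convergence.
-/

noncomputable section

section LaplaceUniqueness

open ProbabilityTheory

variable {Ω : Type*} [MeasurableSpace Ω] {μ : Measure Ω} {X F : Ω → ℝ}

lemma map_eq_map_of_eventuallyEq_mgf {Ω' : Type*} [MeasurableSpace Ω'] {ν : Measure Ω'}
    {Y : Ω' → ℝ} [IsFiniteMeasure μ] [IsFiniteMeasure ν]
    (hX : AEMeasurable X μ) (hY : AEMeasurable Y ν) (hXμ : 0 ∈ interior (integrableExpSet X μ))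
    (hYν : 0 ∈ interior (integrableExpSet Y ν)) (h : mgf X μ =ᶠ[𝓝 0] mgf Y ν) :
    μ.map X = ν.map Y := by
  let strip : Set ℂ :=
    {z | z.re ∈ interior (integrableExpSet X μ) ∩ interior (integrableExpSet Y ν)}
  have hstrip : IsPreconnected strip :=
    ((convex_integrableExpSet.interior.inter convex_integrableExpSet.interior).linear_preimage
      Complex.reLm).isPreconnected
  have hfreq : ∃ᶠ z in 𝓝[≠] (0 : ℂ), complexMGF X μ z = complexMGF Y ν z := by
    have hreal : ∀ᶠ a : ℝ in 𝓝[≠] 0, complexMGF X μ a = complexMGF Y ν a := by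
      filter_upwards [h.filter_mono nhdsWithin_le_nhds] with a ha
      rw [complexMGF_ofReal, complexMGF_ofReal, ha]
    have hlim : Tendsto ((↑) : ℝ → ℂ) (𝓝[≠] 0) (𝓝[≠] 0) :=
      (Complex.continuous_ofReal.tendsto' _ _ Complex.ofReal_zero).inf
        (tendsto_principal_principal.2 fun _ ha => Complex.ofReal_ne_zero.2 ha)
    exact hlim.frequently hreal.frequently
  have heq : EqOn (complexMGF X μ) (complexMGF Y ν) strip :=
    (analyticOnNhd_complexMGF.mono fun _ hz => hz.1).eqOn_of_preconnected_of_frequently_eq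
      (analyticOnNhd_complexMGF.mono fun _ hz => hz.2) hstrip
      (z₀ := 0) ⟨by simpa using hXμ, by simpa using hYν⟩ hfreq
  refine Measure.ext_of_charFun (funext fun t => ?_)
  rw [← complexMGF_mul_I hX, ← complexMGF_mul_I hY]
  exact heq ⟨by simpa using hXμ, by simpa using hYν⟩

lemma toReal_ofReal_mul_exp (u v : ℝ) :
    (ENNReal.ofReal v).toReal * Real.exp u = max (Real.exp u * v) 0 := by
  rw [ENNReal.toReal_ofReal', mul_comm, mul_max_of_nonneg _ _ (Real.exp_nonneg u),
    mul_zero]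

lemma zero_mem_interior_integrableExpSet_withDensity (hF : AEMeasurable F μ)
    (hint : ∀ᶠ a in 𝓝 (0 : ℝ), Integrable (fun ω => Real.exp (a * X ω) * F ω) μ) :
    0 ∈ interior (integrableExpSet X (μ.withDensity fun ω => ENNReal.ofReal (F ω))) := by
  rw [mem_interior_iff_mem_nhds]
  filter_upwards [hint] with a ha
  refine (integrable_withDensity_iff_integrable_smul₀' hF.ennreal_ofReal (by simp)).2 ?_
  simpa only [smul_eq_mul, toReal_ofReal_mul_exp] using ha.pos_part

lemma mgf_withDensity_ofReal (hF : AEMeasurable F μ) (a : ℝ) :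
    mgf X (μ.withDensity fun ω => ENNReal.ofReal (F ω)) a =
      ∫ ω, max (Real.exp (a * X ω) * F ω) 0 ∂μ := by
  rw [mgf, integral_withDensity_eq_integral_toReal_smul₀ hF.ennreal_ofReal (by simp)]
  simp only [smul_eq_mul, toReal_ofReal_mul_exp]

lemma ae_eq_zero_of_eventually_integral_exp_mul_eq_zero {Y : ℝ → Ω} (hX : Measurable X)
    (hY : Measurable Y) (hYX : ∀ᵐ ω ∂μ, Y (X ω) = ω)
    (hint : ∀ᶠ a in 𝓝 (0 : ℝ), Integrable (fun ω => Real.exp (a * X ω) * F ω) μ)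
    (hzero : ∀ᶠ a in 𝓝 (0 : ℝ), ∫ ω, Real.exp (a * X ω) * F ω ∂μ = 0) : F =ᵐ[μ] 0 := by
  have hF : Integrable F μ := by simpa using hint.self_of_nhds
  have hF_neg : Integrable (fun ω => -F ω) μ := hF.neg
  have hint_neg : ∀ᶠ a in 𝓝 (0 : ℝ), Integrable (fun ω => Real.exp (a * X ω) * -F ω) μ := by
    filter_upwards [hint] with a ha
    exact ha.neg.congr (.of_forall fun ω => (mul_neg _ _).symm)
  let P := μ.withDensity fun ω => ENNReal.ofReal (F ω)
  let Q := μ.withDensity fun ω => ENNReal.ofReal (-F ω)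
  have : IsFiniteMeasure P := isFiniteMeasure_withDensity_ofReal hF.2
  have : IsFiniteMeasure Q := isFiniteMeasure_withDensity_ofReal hF_neg.2
  have hmgf : mgf X P =ᶠ[𝓝 0] mgf X Q := by
    filter_upwards [hint, hzero] with a ha ha0
    rw [integral_eq_integral_pos_part_sub_integral_neg_part ha, sub_eq_zero] at ha0
    simpa only [P, Q, mgf_withDensity_ofReal hF.aemeasurable,
      mgf_withDensity_ofReal hF_neg.aemeasurable, mul_neg, Real.coe_toNNReal']
      using ha0
  have hmap : P.map X = Q.map X := map_eq_map_of_eventuallyEq_mgf hX.aemeasurable hX.aemeasurable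
    (zero_mem_interior_integrableExpSet_withDensity hF.aemeasurable hint)
    (zero_mem_interior_integrableExpSet_withDensity hF_neg.aemeasurable hint_neg) hmgf
  have hrecover : ∀ R : Measure Ω, R ≪ μ → (R.map X).map Y = R := fun R hR => by
    rw [Measure.map_map hY hX, Measure.map_congr (hR.ae_le hYX : Y ∘ X =ᵐ[R] id), Measure.map_id]
  have hPQ : P = Q := by
    rw [← hrecover P (withDensity_absolutelyContinuous _ _), hmap,
      hrecover Q (withDensity_absolutelyContinuous _ _)]
  have hdensity := (withDensity_eq_iff hF.aemeasurable.ennreal_ofReal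
    hF_neg.aemeasurable.ennreal_ofReal hF.lintegral_lt_top.ne).1 hPQ
  filter_upwards [hdensity] with ω hω
  have hmax := congrArg ENNReal.toReal hω
  simp only [ENNReal.toReal_ofReal'] at hmax
  rw [Pi.zero_apply, ← max_zero_sub_max_neg_zero_eq_self (F ω), hmax, sub_self]

lemma ae_eq_zero_of_eventually_integral_exp_smul_eq_zero {𝕜 : Type*} [RCLike 𝕜] {F : Ω → 𝕜}
    {Y : ℝ → Ω} (hX : Measurable X) (hY : Measurable Y) (hYX : ∀ᵐ ω ∂μ, Y (X ω) = ω)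
    (hint : ∀ᶠ a in 𝓝 (0 : ℝ), Integrable (fun ω => Real.exp (a * X ω) • F ω) μ)
    (hzero : ∀ᶠ a in 𝓝 (0 : ℝ), ∫ ω, Real.exp (a * X ω) • F ω ∂μ = 0) : F =ᵐ[μ] 0 := by
  have hre : (fun ω => RCLike.re (F ω)) =ᵐ[μ] 0 := by
    refine ae_eq_zero_of_eventually_integral_exp_mul_eq_zero hX hY hYX ?_ ?_
    · filter_upwards [hint] with a ha
      simpa only [RCLike.smul_re] using ha.re
    · filter_upwards [hint, hzero] with a ha ha0
      simpa only [RCLike.smul_re, ha0, map_zero] using integral_re ha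
  have him : (fun ω => RCLike.im (F ω)) =ᵐ[μ] 0 := by
    refine ae_eq_zero_of_eventually_integral_exp_mul_eq_zero hX hY hYX ?_ ?_
    · filter_upwards [hint] with a ha
      simpa only [RCLike.smul_im] using ha.im
    · filter_upwards [hint, hzero] with a ha ha0
      simpa only [RCLike.smul_im, ha0, map_zero] using integral_im ha
  filter_upwards [hre, him] with ω hω_re hω_im
  exact RCLike.ext (by simpa using hω_re) (by simpa using hω_im)

end LaplaceUniqueness

section MarkovOperators

variable {X : Type*} [MeasurableSpace X] {𝕜 : Type*} [RCLike 𝕜] {μ : Measure X}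

namespace MemL1AddLinf

lemma of_memLp {p : ℝ≥0∞} (hp : 1 ≤ p) {f : X → 𝕜} (hf : MemLp f p μ) : MemL1AddLinf μ f := by
  rcases eq_or_ne p ∞ with rfl | hp_top
  · exact ⟨0, f, .zero, hf, by simp⟩
  obtain ⟨g, hg_meas, hfg⟩ := hf.1
  have hg : MemLp g p μ := hf.ae_eq hfg
  let large : Set X := {x | 1 ≤ ‖g x‖}
  have hlarge : MeasurableSet large := measurableSet_le measurable_const hg_meas.norm.measurable
  have hlarge_finite : μ large ≠ ∞ := by
    have hmarkov := hg.meas_ge_lt_top (ε := 1) (zero_lt_one.trans_le hp).ne' hp_top one_ne_zero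
    exact ((measure_mono fun x (hx : 1 ≤ ‖g x‖) => by exact_mod_cast hx).trans_lt hmarkov).ne
  refine ⟨large.indicator g, largeᶜ.indicator g, ?_, ?_, ?_⟩
  · exact (hg.indicator hlarge).mono_exponent_of_measure_support_ne_top
      (fun x hx => indicator_of_notMem hx _) hlarge_finite hp
  · refine memLp_top_of_bound (hg_meas.indicator hlarge.compl).aestronglyMeasurable 1
      (.of_forall fun x => ?_)
    by_cases hx : x ∈ large
    · rw [indicator_of_notMem (notMem_compl_iff.2 hx), norm_zero]
      exact zero_le_one
    · rw [indicator_of_mem hx]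
      exact (not_le.1 hx).le
  · rwa [indicator_self_add_compl]

lemma aestronglyMeasurable {f : X → 𝕜} (hf : MemL1AddLinf μ f) : AEStronglyMeasurable f μ := by
  obtain ⟨g, h, hg, hh, hfgh⟩ := hf
  exact (hg.1.add hh.1).congr hfgh.symm

end MemL1AddLinf

/-- A single operator of a Markovian symmetric diffusion semigroup: the conditions of
`IsMarkovianSymmetricDiffusionSemigroup` that do not compare different times. -/
structure IsSymmMarkovOperator (μ : Measure X) (S : (X → 𝕜) → (X → 𝕜)) : Prop where
  congr_ae : ∀ f g, MemL1AddLinf μ f → f =ᵐ[μ] g → S f =ᵐ[μ] S g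
  aestronglyMeasurable : ∀ f, MemL1AddLinf μ f → AEStronglyMeasurable (S f) μ
  map_add : ∀ f g, MemL1AddLinf μ f → MemL1AddLinf μ g → S (f + g) =ᵐ[μ] S f + S g
  map_smul : ∀ (c : 𝕜) f, MemL1AddLinf μ f → S (c • f) =ᵐ[μ] c • S f
  contraction : ∀ p : ℝ≥0∞, 1 ≤ p → ∀ f, MemLp f p μ →
    MemLp (S f) p μ ∧ eLpNorm (S f) p μ ≤ eLpNorm f p μ
  selfAdjoint : ∀ f g, MemLp f 2 μ → MemLp g 2 μ →
    ∫ x, inner 𝕜 (S f x) (g x) ∂μ = ∫ x, inner 𝕜 (f x) (S g x) ∂μ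
  nonneg : ∀ f, MemL1AddLinf μ f → 0 ≤ᵐ[μ] f → 0 ≤ᵐ[μ] S f
  conservative : S (fun _ => 1) =ᵐ[μ] fun _ => 1

namespace IsSymmMarkovOperator

lemma id (μ : Measure X) : IsSymmMarkovOperator μ (fun f : X → 𝕜 => f) where
  congr_ae _ _ _ hfg := hfg
  aestronglyMeasurable _ hf := hf.aestronglyMeasurable
  map_add _ _ _ _ := .rfl
  map_smul _ _ _ := .rfl
  contraction _ _ _ hf := ⟨hf, le_rfl⟩
  selfAdjoint _ _ _ _ := rfl
  nonneg _ _ hf := hf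
  conservative := .rfl

lemma congr {S S' : (X → 𝕜) → (X → 𝕜)} (hS : IsSymmMarkovOperator μ S)
    (h : ∀ f, S' f =ᵐ[μ] S f) : IsSymmMarkovOperator μ S' where
  congr_ae f g hf hfg := (h f).trans ((hS.congr_ae f g hf hfg).trans (h g).symm)
  aestronglyMeasurable f hf := (hS.aestronglyMeasurable f hf).congr (h f).symm
  map_add f g hf hg := (h _).trans ((hS.map_add f g hf hg).trans ((h f).symm.add (h g).symm))
  map_smul c f hf := (h _).trans ((hS.map_smul c f hf).trans ((h f).symm.const_smul c))
  contraction p hp f hf := by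
    obtain ⟨hmem, hnorm⟩ := hS.contraction p hp f hf
    exact ⟨hmem.ae_eq (h f).symm, (eLpNorm_congr_ae (h f)).trans_le hnorm⟩
  selfAdjoint f g hf hg := by
    calc ∫ x, inner 𝕜 (S' f x) (g x) ∂μ
        = ∫ x, inner 𝕜 (S f x) (g x) ∂μ :=
          integral_congr_ae ((h f).mono fun x hx => by simp only [hx])
      _ = ∫ x, inner 𝕜 (f x) (S g x) ∂μ := hS.selfAdjoint f g hf hg
      _ = ∫ x, inner 𝕜 (f x) (S' g x) ∂μ :=
          integral_congr_ae ((h g).mono fun x hx => by simp only [hx])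
  nonneg f hf hf0 := (hS.nonneg f hf hf0).trans_eq (h f).symm
  conservative := (h _).trans hS.conservative

end IsSymmMarkovOperator

/-- The integral operator with kernel `k`. -/
def kernelOp (μ : Measure X) (k : X → X → ℝ) (f : X → 𝕜) (x : X) : 𝕜 := ∫ y, k x y • f y ∂μ

/-- The kernel of the composition of the integral operators with kernels `k₁` and `k₂`. -/
def kernelComp (μ : Measure X) (k₁ k₂ : X → X → ℝ) (x y : X) : ℝ := ∫ z, k₁ x z * k₂ z y ∂μ

lemma kernelOp_congr_ae {k : X → X → ℝ} {f g : X → 𝕜} (h : f =ᵐ[μ] g) :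
    kernelOp μ k f = kernelOp μ k g :=
  funext fun _ => integral_congr_ae (h.mono fun y hy => by simp only [hy])

lemma kernelOp_congr_kernel_ae {k₁ k₂ : X → X → ℝ} {x : X} (h : k₁ x =ᵐ[μ] k₂ x) (f : X → 𝕜) :
    kernelOp μ k₁ f x = kernelOp μ k₂ f x :=
  integral_congr_ae (h.mono fun y hy => by simp only [hy])

lemma kernelOp_smul (k : X → X → ℝ) (c : 𝕜) (f : X → 𝕜) :
    kernelOp μ k (c • f) = c • kernelOp μ k f :=
  funext fun x => by simp only [kernelOp, Pi.smul_apply, smul_comm _ c, integral_smul]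

lemma aestronglyMeasurable_kernelOp [SFinite μ] {k : X → X → ℝ}
    (hk : Measurable (Function.uncurry k)) {f : X → 𝕜} (hf : AEStronglyMeasurable f μ) :
    AEStronglyMeasurable (kernelOp μ k f) μ :=
  AEStronglyMeasurable.integral_prod_right' (f := fun z : X × X => k z.1 z.2 • f z.2)
    (hk.aestronglyMeasurable.smul hf.comp_snd)

/-- Symmetric Markov kernels with bounded sections, as densities with respect to `μ`. -/
structure IsSymmMarkovKernel (μ : Measure X) (k : X → X → ℝ) : Prop where
  measurable : Measurable (Function.uncurry k)
  nonneg : ∀ x y, 0 ≤ k x y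
  symm : ∀ x y, k x y = k y x
  bounded : ∀ x, ∃ C, ∀ y, k x y ≤ C
  integral_eq_one : ∀ x, ∫ y, k x y ∂μ = 1

namespace IsSymmMarkovKernel

variable {k k₁ k₂ : X → X → ℝ}

lemma measurable_section (hk : IsSymmMarkovKernel μ k) (x : X) : Measurable (k x) :=
  hk.measurable.comp measurable_prodMk_left

lemma integrable (hk : IsSymmMarkovKernel μ k) (x : X) : Integrable (k x) μ :=
  .of_integral_ne_zero (by rw [hk.integral_eq_one]; exact one_ne_zero)

lemma lintegral_enorm_eq_one (hk : IsSymmMarkovKernel μ k) (x : X) :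
    ∫⁻ y, ‖k x y‖ₑ ∂μ = 1 := by
  rw [← ofReal_integral_norm_eq_lintegral_enorm (hk.integrable x)]
  simp only [Real.norm_of_nonneg (hk.nonneg _ _), hk.integral_eq_one, ENNReal.ofReal_one]

lemma integrable_smul (hk : IsSymmMarkovKernel μ k) {f : X → 𝕜} (hf : MemL1AddLinf μ f) (x : X) :
    Integrable (fun y => k x y • f y) μ := by
  obtain ⟨g, h, hg, hh, hfgh⟩ := hf
  obtain ⟨C, hC⟩ := hk.bounded x
  have hkg : Integrable (k x • g) μ :=
    (memLp_one_iff_integrable.1 hg).bdd_smul C (hk.measurable_section x).aestronglyMeasurable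
      (.of_forall fun y => by rw [Real.norm_of_nonneg (hk.nonneg x y)]; exact hC y)
  have hkh : Integrable (k x • h) μ := (hk.integrable x).smul_of_top_left hh
  refine (hkg.add hkh).congr (hfgh.mono fun y hy => ?_)
  simp only [hy, Pi.add_apply, Pi.smul_apply', smul_add]

lemma lintegral_lintegral_mul [SFinite μ] (hk : IsSymmMarkovKernel μ k) {g : X → ℝ≥0∞}
    (hg : AEMeasurable g μ) : ∫⁻ x, ∫⁻ y, ‖k x y‖ₑ * g y ∂μ ∂μ = ∫⁻ y, g y ∂μ := by
  have hmeas : AEMeasurable (fun z : X × X => ‖k z.1 z.2‖ₑ * g z.2) (μ.prod μ) :=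
    hk.measurable.enorm.aemeasurable.mul hg.comp_snd
  rw [lintegral_lintegral_swap hmeas]
  refine lintegral_congr fun y => ?_
  simp only [hk.symm _ y]
  rw [lintegral_mul_const _ (hk.measurable_section y).enorm, hk.lintegral_enorm_eq_one, one_mul]

lemma enorm_kernelOp_le (hk : IsSymmMarkovKernel μ k) {f : X → 𝕜}
    (hf : AEStronglyMeasurable f μ) {p : ℝ≥0∞} (hp : 1 ≤ p) (x : X) :
    ‖kernelOp μ k f x‖ₑ ≤ eLpNorm f p (μ.withDensity fun y => ‖k x y‖ₑ) := by
  have hprob : IsProbabilityMeasure (μ.withDensity fun y => ‖k x y‖ₑ) :=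
    ⟨by rw [withDensity_apply _ .univ, setLIntegral_univ, hk.lintegral_enorm_eq_one]⟩
  calc ‖kernelOp μ k f x‖ₑ
      ≤ ∫⁻ y, ‖k x y • f y‖ₑ ∂μ := enorm_integral_le_lintegral_enorm _
    _ = eLpNorm f 1 (μ.withDensity fun y => ‖k x y‖ₑ) := by
        rw [eLpNorm_one_eq_lintegral_enorm, lintegral_withDensity_eq_lintegral_mul₀
          (hk.measurable_section x).enorm.aemeasurable hf.enorm]
        simp only [enorm_smul, Pi.mul_apply]
    _ ≤ eLpNorm f p (μ.withDensity fun y => ‖k x y‖ₑ) :=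
        eLpNorm_le_eLpNorm_of_exponent_le hp (hf.mono_ac (withDensity_absolutelyContinuous _ _))

lemma eLpNorm_kernelOp_le [SFinite μ] (hk : IsSymmMarkovKernel μ k) {f : X → 𝕜}
    (hf : AEStronglyMeasurable f μ) {p : ℝ≥0∞} (hp : 1 ≤ p) :
    eLpNorm (kernelOp μ k f) p μ ≤ eLpNorm f p μ := by
  rcases eq_or_ne p ∞ with rfl | hp_top
  · rw [eLpNorm_exponent_top, eLpNorm_exponent_top]
    refine essSup_le_of_ae_le _ (.of_forall fun x => ?_)
    refine (hk.enorm_kernelOp_le hf le_top x).trans ?_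
    rw [eLpNorm_exponent_top]
    exact essSup_mono_measure (withDensity_absolutelyContinuous _ _)
  have hp0 : p ≠ 0 := (zero_lt_one.trans_le hp).ne'
  have hfp : AEMeasurable (fun y => ‖f y‖ₑ ^ p.toReal) μ := hf.enorm.pow_const _
  have hjensen : ∀ x, ‖kernelOp μ k f x‖ₑ ^ p.toReal ≤
      ∫⁻ y, ‖k x y‖ₑ * ‖f y‖ₑ ^ p.toReal ∂μ := fun x => by
    have hx := hk.enorm_kernelOp_le hf hp x
    rwa [eLpNorm_eq_lintegral_rpow_enorm_toReal hp0 hp_top, one_div,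
      ENNReal.le_rpow_inv_iff (ENNReal.toReal_pos hp0 hp_top),
      lintegral_withDensity_eq_lintegral_mul₀ (hk.measurable_section x).enorm.aemeasurable hfp]
      at hx
  rw [eLpNorm_eq_lintegral_rpow_enorm_toReal hp0 hp_top,
    eLpNorm_eq_lintegral_rpow_enorm_toReal hp0 hp_top]
  refine ENNReal.rpow_le_rpow ?_ (by positivity)
  rw [← hk.lintegral_lintegral_mul hfp]
  exact lintegral_mono hjensen

lemma memLp_kernelOp [SFinite μ] (hk : IsSymmMarkovKernel μ k) {f : X → 𝕜} {p : ℝ≥0∞}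
    (hp : 1 ≤ p) (hf : MemLp f p μ) : MemLp (kernelOp μ k f) p μ :=
  ⟨aestronglyMeasurable_kernelOp hk.measurable hf.1,
    (hk.eLpNorm_kernelOp_le hf.1 hp).trans_lt hf.2⟩

lemma integrable_prod_mul_sq [SFinite μ] (hk : IsSymmMarkovKernel μ k) {f : X → 𝕜}
    (hf : MemLp f 2 μ) : Integrable (fun z : X × X => k z.1 z.2 * ‖f z.2‖ ^ 2) (μ.prod μ) := by
  have hf_sq : Integrable (fun y => ‖f y‖ ^ 2) μ := hf.integrable_norm_pow two_ne_zero
  have hmeas : AEStronglyMeasurable (fun z : X × X => k z.1 z.2 * ‖f z.2‖ ^ 2) (μ.prod μ) :=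
    hk.measurable.aestronglyMeasurable.mul hf_sq.1.comp_snd
  refine ⟨hmeas, ?_⟩
  rw [HasFiniteIntegral, lintegral_prod _ hmeas.enorm]
  simp only [enorm_mul]
  rw [hk.lintegral_lintegral_mul hf_sq.1.enorm]
  exact hf_sq.2

lemma integrable_prod_smul_inner [SFinite μ] (hk : IsSymmMarkovKernel μ k) {f g : X → 𝕜}
    (hf : MemLp f 2 μ) (hg : MemLp g 2 μ) :
    Integrable (fun z : X × X => k z.1 z.2 • inner 𝕜 (f z.2) (g z.1)) (μ.prod μ) := by
  refine ((hk.integrable_prod_mul_sq hf).add (hk.integrable_prod_mul_sq hg).swap).mono'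
    (hk.measurable.aestronglyMeasurable.smul (hf.1.comp_snd.inner hg.1.comp_fst))
    (.of_forall fun z => ?_)
  simp only [Pi.add_apply, Function.comp_apply, Prod.fst_swap, Prod.snd_swap]
  rw [norm_smul, Real.norm_of_nonneg (hk.nonneg _ _), hk.symm z.2 z.1, ← mul_add]
  refine mul_le_mul_of_nonneg_left ((norm_inner_le_norm _ _).trans ?_) (hk.nonneg _ _)
  nlinarith [sq_nonneg (‖f z.2‖ - ‖g z.1‖), sq_nonneg ‖f z.2‖, sq_nonneg ‖g z.1‖]

lemma integral_inner_kernelOp [SFinite μ] (hk : IsSymmMarkovKernel μ k) {f g : X → 𝕜}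
    (hf : MemLp f 2 μ) (hg : MemLp g 2 μ) :
    ∫ x, inner 𝕜 (kernelOp μ k f x) (g x) ∂μ = ∫ x, inner 𝕜 (f x) (kernelOp μ k g x) ∂μ := by
  have hleft : ∀ x, inner 𝕜 (kernelOp μ k f x) (g x) =
      ∫ y, k x y • inner 𝕜 (f y) (g x) ∂μ := fun x => by
    rw [← inner_conj_symm, kernelOp,
      ← integral_inner (hk.integrable_smul (.of_memLp one_le_two hf) x), ← integral_conj]
    congr 1 with y
    rw [inner_conj_symm, inner_smul_left_eq_smul]
  have hright : ∀ y, inner 𝕜 (f y) (kernelOp μ k g y) =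
      ∫ x, k x y • inner 𝕜 (f y) (g x) ∂μ := fun y => by
    rw [kernelOp, ← integral_inner (hk.integrable_smul (.of_memLp one_le_two hg) y)]
    congr 1 with x
    rw [inner_smul_right_eq_smul, hk.symm]
  simp only [hleft, hright]
  exact integral_integral_swap (hk.integrable_prod_smul_inner hf hg)

lemma kernelOp_nonneg (hk : IsSymmMarkovKernel μ k) {f : X → 𝕜} (hf : MemL1AddLinf μ f)
    (hf0 : 0 ≤ᵐ[μ] f) (x : X) : 0 ≤ kernelOp μ k f x := by
  have hint := hk.integrable_smul hf x
  rw [RCLike.nonneg_iff, kernelOp, ← integral_re hint, ← integral_im hint]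
  constructor
  · refine integral_nonneg_of_ae (hf0.mono fun y hy => ?_)
    simp only [Pi.zero_apply, RCLike.smul_re]
    exact mul_nonneg (hk.nonneg x y) (RCLike.nonneg_iff.1 hy).1
  · refine integral_eq_zero_of_ae (hf0.mono fun y hy => ?_)
    simp only [RCLike.smul_im, (RCLike.nonneg_iff.1 hy).2, mul_zero, Pi.zero_apply]

lemma isSymmMarkovOperator_kernelOp [SFinite μ] (hk : IsSymmMarkovKernel μ k) :
    IsSymmMarkovOperator μ (kernelOp μ k : (X → 𝕜) → (X → 𝕜)) where
  congr_ae _ _ _ hfg := (kernelOp_congr_ae hfg).eventuallyEq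
  aestronglyMeasurable _ hf := aestronglyMeasurable_kernelOp hk.measurable hf.aestronglyMeasurable
  map_add f g hf hg := .of_forall fun x => by
    simp only [kernelOp, Pi.add_apply, smul_add]
    exact integral_add (hk.integrable_smul hf x) (hk.integrable_smul hg x)
  map_smul c f _ := (kernelOp_smul k c f).eventuallyEq
  contraction _ hp _ hf := ⟨hk.memLp_kernelOp hp hf, hk.eLpNorm_kernelOp_le hf.1 hp⟩
  selfAdjoint _ _ hf hg := hk.integral_inner_kernelOp hf hg
  nonneg _ hf hf0 := .of_forall (hk.kernelOp_nonneg hf hf0)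
  conservative := .of_forall fun x => by
    rw [kernelOp, integral_smul_const, hk.integral_eq_one, one_smul]

lemma integrable_prod_mul_smul_of_memLp [SFinite μ] (h₁ : IsSymmMarkovKernel μ k₁)
    (h₂ : IsSymmMarkovKernel μ k₂) {f : X → 𝕜} {p : ℝ≥0∞} (hp : 1 ≤ p) (hf : MemLp f p μ)
    (x : X) : Integrable (fun w : X × X => (k₁ x w.1 * k₂ w.1 w.2) • f w.2) (μ.prod μ) := by
  have hmeas : AEStronglyMeasurable (fun w : X × X => (k₁ x w.1 * k₂ w.1 w.2) • f w.2)
      (μ.prod μ) :=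
    (((h₁.measurable_section x).comp measurable_fst).mul h₂.measurable).aestronglyMeasurable.smul
      hf.1.comp_snd
  refine (integrable_prod_iff hmeas).2 ⟨.of_forall fun z => ?_, ?_⟩
  · exact ((h₂.integrable_smul (.of_memLp hp hf) z).smul (k₁ x z)).congr
      (.of_forall fun y => (mul_smul (k₁ x z) (k₂ z y) (f y)).symm)
  · have hnorm := h₂.memLp_kernelOp hp hf.norm
    refine (h₁.integrable_smul (.of_memLp hp hnorm) x).congr (.of_forall fun z => ?_)
    simp only [kernelOp, norm_smul, norm_mul, Real.norm_of_nonneg (h₁.nonneg _ _),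
      Real.norm_of_nonneg (h₂.nonneg _ _), smul_eq_mul, ← integral_const_mul, mul_assoc]

lemma integrable_prod_mul_smul [SFinite μ] (h₁ : IsSymmMarkovKernel μ k₁)
    (h₂ : IsSymmMarkovKernel μ k₂) {f : X → 𝕜} (hf : MemL1AddLinf μ f) (x : X) :
    Integrable (fun w : X × X => (k₁ x w.1 * k₂ w.1 w.2) • f w.2) (μ.prod μ) := by
  obtain ⟨g, h, hg, hh, hfgh⟩ := hf
  refine ((h₁.integrable_prod_mul_smul_of_memLp h₂ le_rfl hg x).add
    (h₁.integrable_prod_mul_smul_of_memLp h₂ le_top hh x)).congr ?_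
  filter_upwards [Measure.quasiMeasurePreserving_snd.ae_eq_comp hfgh] with w hw
  simp only [Function.comp_apply, Pi.add_apply] at hw ⊢
  rw [hw, smul_add]

lemma integrable_kernelComp_smul [SFinite μ] (h₁ : IsSymmMarkovKernel μ k₁)
    (h₂ : IsSymmMarkovKernel μ k₂) {f : X → 𝕜} (hf : MemL1AddLinf μ f) (x : X) :
    Integrable (fun y => kernelComp μ k₁ k₂ x y • f y) μ := by
  simpa only [kernelComp, integral_smul_const] using
    (h₁.integrable_prod_mul_smul h₂ hf x).integral_prod_right

lemma kernelOp_kernelComp [SFinite μ] (h₁ : IsSymmMarkovKernel μ k₁)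
    (h₂ : IsSymmMarkovKernel μ k₂) {f : X → 𝕜} (hf : MemL1AddLinf μ f) (x : X) :
    kernelOp μ (kernelComp μ k₁ k₂) f x = kernelOp μ k₁ (kernelOp μ k₂ f) x := by
  simp only [kernelOp, kernelComp, ← integral_smul_const, ← integral_smul, smul_smul]
  exact (integral_integral_swap (h₁.integrable_prod_mul_smul h₂ hf x)).symm

end IsSymmMarkovKernel

end MarkovOperators

section Gaussian

/-- The Gaussian `x ↦ exp (-a x²)`. Negative parameters are allowed, so that Gaussian growth
bounds can be written in the same notation. -/
def gaussian (a x : ℝ) : ℝ := Real.exp (-a * x ^ 2)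

lemma gaussian_neg (a x : ℝ) : gaussian (-a) x = Real.exp (a * x ^ 2) := by
  rw [gaussian, neg_neg]

lemma gaussian_pos (a x : ℝ) : 0 < gaussian a x := Real.exp_pos _

lemma gaussian_mul_gaussian (a b x : ℝ) : gaussian a x * gaussian b x = gaussian (a + b) x := by
  rw [gaussian, gaussian, gaussian, ← Real.exp_add]
  ring_nf

lemma gaussian_mul_gaussian_neg (a x : ℝ) : gaussian a x * gaussian (-a) x = 1 := by
  rw [gaussian_mul_gaussian, add_neg_cancel, gaussian, neg_zero, zero_mul, Real.exp_zero]

lemma gaussian_le_one {a : ℝ} (ha : 0 ≤ a) (x : ℝ) : gaussian a x ≤ 1 :=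
  Real.exp_le_one_iff.2 (by nlinarith [mul_nonneg ha (sq_nonneg x)])

lemma norm_gaussian (a x : ℝ) : ‖gaussian a x‖ = gaussian a x :=
  Real.norm_of_nonneg (gaussian_pos a x).le

lemma continuous_gaussian (a : ℝ) : Continuous (gaussian a) := by
  unfold gaussian
  fun_prop

lemma ae_eq_of_eventually_integral_gaussian_smul_eq {𝕜 : Type*} [RCLike 𝕜] {μ : Measure ℝ}
    (hμ : ∀ᵐ x ∂μ, 0 < x) {F G : ℝ → 𝕜}
    (hF : ∀ᶠ a in atTop, Integrable (fun x => gaussian a x • F x) μ)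
    (hG : ∀ᶠ a in atTop, Integrable (fun x => gaussian a x • G x) μ)
    (h : ∀ᶠ a in atTop, ∫ x, gaussian a x • F x ∂μ = ∫ x, gaussian a x • G x ∂μ) :
    F =ᵐ[μ] G := by
  obtain ⟨c, hc⟩ := eventually_atTop.1 (hF.and (hG.and h))
  have hnear : ∀ᶠ a : ℝ in 𝓝 0, c ≤ c + 1 + a := by
    filter_upwards [eventually_gt_nhds (neg_one_lt_zero : (-1 : ℝ) < 0)] with a ha
    linarith
  have hshift : ∀ a x, Real.exp (a * -x ^ 2) • (gaussian (c + 1) x • (F x - G x)) =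
      gaussian (c + 1 + a) x • F x - gaussian (c + 1 + a) x • G x := fun a x => by
    rw [← gaussian_mul_gaussian (c + 1), ← smul_sub, mul_comm (gaussian _ _), mul_smul, gaussian,
      gaussian, mul_neg, ← neg_mul]
  have hzero : (fun x => gaussian (c + 1) x • (F x - G x)) =ᵐ[μ] 0 := by
    refine ae_eq_zero_of_eventually_integral_exp_smul_eq_zero (X := fun x => -x ^ 2)
      (Y := fun u => √(-u)) (by fun_prop) (by fun_prop) ?_ ?_ ?_
    · filter_upwards [hμ] with x hx
      rw [neg_neg, Real.sqrt_sq hx.le]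
    all_goals filter_upwards [hnear] with a ha
    · exact ((hc _ ha).1.sub (hc _ ha).2.1).congr (.of_forall fun x => (hshift a x).symm)
    · simp only [hshift]
      rw [integral_sub (hc _ ha).1 (hc _ ha).2.1, sub_eq_zero, (hc _ ha).2.2]
  filter_upwards [hzero] with x hx
  exact sub_eq_zero.1 ((smul_eq_zero.1 hx).resolve_left (gaussian_pos _ _).ne')

end Gaussian

section BesselMeasure

variable {E : Type*} [NormedAddCommGroup E] [NormedSpace ℝ E] {α : ℝ}

lemma ae_besselMeasure_pos (α : ℝ) : ∀ᵐ x ∂(besselMeasure α), 0 < x :=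
  (withDensity_absolutelyContinuous _ _).ae_le (ae_restrict_mem measurableSet_Ioi)

lemma measurable_besselDensity (α : ℝ) :
    Measurable fun x : ℝ => ENNReal.ofReal (x ^ (2 * α + 1)) := by fun_prop

lemma integral_besselMeasure (α : ℝ) (f : ℝ → E) :
    ∫ x, f x ∂(besselMeasure α) = ∫ x in Ioi (0 : ℝ), x ^ (2 * α + 1) • f x := by
  rw [besselMeasure, integral_withDensity_eq_integral_toReal_smul (measurable_besselDensity α)
    (by simp)]
  refine setIntegral_congr_fun measurableSet_Ioi fun x (hx : 0 < x) => ?_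
  rw [ENNReal.toReal_ofReal (by positivity)]

lemma integrable_besselMeasure_iff (α : ℝ) (f : ℝ → E) :
    Integrable f (besselMeasure α) ↔
      IntegrableOn (fun x => x ^ (2 * α + 1) • f x) (Ioi (0 : ℝ)) := by
  rw [besselMeasure, integrable_withDensity_iff_integrable_smul' (measurable_besselDensity α)
    (by simp)]
  refine integrable_congr ?_
  filter_upwards [ae_restrict_mem measurableSet_Ioi] with x (hx : 0 < x)
  rw [ENNReal.toReal_ofReal (by positivity)]

lemma rpow_mul_pow_mul_gaussian (α a : ℝ) (k : ℕ) {x : ℝ} (hx : 0 < x) :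
    x ^ (2 * α + 1) * (x ^ (2 * k) * gaussian a x) =
      x ^ (2 * α + 1 + 2 * (k : ℝ)) * Real.exp (-a * x ^ (2 : ℝ)) := by
  have hcast : ((2 * k : ℕ) : ℝ) = 2 * k := by push_cast; rfl
  rw [gaussian, ← mul_assoc, Real.rpow_add hx (2 * α + 1), Real.rpow_two,
    ← Real.rpow_natCast x (2 * k), hcast]

lemma integrable_pow_mul_gaussian (hα : -1 < α) {a : ℝ} (ha : 0 < a) (k : ℕ) :
    Integrable (fun x => x ^ (2 * k) * gaussian a x) (besselMeasure α) := by
  rw [integrable_besselMeasure_iff]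
  have hexp : -1 < 2 * α + 1 + 2 * (k : ℝ) := by
    have := k.cast_nonneg (α := ℝ)
    linarith
  refine (integrableOn_rpow_mul_exp_neg_mul_sq ha hexp).congr_fun (fun x (hx : 0 < x) => ?_)
    measurableSet_Ioi
  simp only [smul_eq_mul, rpow_mul_pow_mul_gaussian α a k hx, Real.rpow_two]

lemma integral_pow_mul_gaussian (hα : -1 < α) {a : ℝ} (ha : 0 < a) (k : ℕ) :
    ∫ x, x ^ (2 * k) * gaussian a x ∂(besselMeasure α) =
      1 / 2 * a ^ (-α - 1) * (Real.Gamma (k + α + 1) / a ^ k) := by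
  have hexp : -1 < 2 * α + 1 + 2 * (k : ℝ) := by
    have := k.cast_nonneg (α := ℝ)
    linarith
  calc ∫ x, x ^ (2 * k) * gaussian a x ∂(besselMeasure α)
      = ∫ x in Ioi (0 : ℝ), x ^ (2 * α + 1 + 2 * (k : ℝ)) * Real.exp (-a * x ^ (2 : ℝ)) := by
        rw [integral_besselMeasure]
        exact setIntegral_congr_fun measurableSet_Ioi fun x hx =>
          rpow_mul_pow_mul_gaussian α a k hx
    _ = a ^ ((-α - 1) - k) * (1 / 2) * Real.Gamma (k + α + 1) := by
        rw [integral_rpow_mul_exp_neg_mul_rpow two_pos hexp ha]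
        ring_nf
    _ = 1 / 2 * a ^ (-α - 1) * (Real.Gamma (k + α + 1) / a ^ k) := by
        rw [Real.rpow_sub_natCast ha.ne']
        ring

lemma integrable_gaussian (hα : -1 < α) {a : ℝ} (ha : 0 < a) :
    Integrable (gaussian a) (besselMeasure α) := by
  simpa using integrable_pow_mul_gaussian hα ha 0

lemma integral_gaussian_besselMeasure (hα : -1 < α) {a : ℝ} (ha : 0 < a) :
    ∫ x, gaussian a x ∂(besselMeasure α) = 1 / 2 * a ^ (-α - 1) * Real.Gamma (α + 1) := by
  simpa using integral_pow_mul_gaussian hα ha 0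

end BesselMeasure

section BesselClifford

variable {α : ℝ}

/-- The Bessel–Clifford function `∑ w^k / (k! Γ(k + α + 1))`, an entire function of `w` with
`J_α(z) = (z/2)^α besselClifford α (-z²/4)` and `I_α(z) = (z/2)^α besselClifford α (z²/4)`. -/
def besselClifford (α w : ℝ) : ℝ :=
  ∑' k : ℕ, w ^ k / (k.factorial * Real.Gamma (k + α + 1))

lemma natCast_add_add_one_pos (hα : -1 < α) (k : ℕ) : 0 < (k : ℝ) + α + 1 := by
  have := k.cast_nonneg (α := ℝ)
  linarith

lemma Gamma_natCast_add_add_one_pos (hα : -1 < α) (k : ℕ) : 0 < Real.Gamma (k + α + 1) :=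
  Real.Gamma_pos_of_pos (natCast_add_add_one_pos hα k)

lemma Gamma_add_one_pos (hα : -1 < α) : 0 < Real.Gamma (α + 1) :=
  Real.Gamma_pos_of_pos (neg_lt_iff_pos_add.1 hα)

lemma Gamma_mul_pow_mul_factorial_le (hα : -1 < α) {m : ℝ} (hm0 : 0 ≤ m) (hm1 : m ≤ 1)
    (hmα : m ≤ 1 + α) (k : ℕ) :
    Real.Gamma (α + 1) * m ^ k * k.factorial ≤ Real.Gamma (k + α + 1) := by
  induction k with
  | zero => simp
  | succ k ih =>
    have hpos := natCast_add_add_one_pos hα k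
    have hfactor : m * (k + 1) ≤ k + α + 1 := by nlinarith [k.cast_nonneg (α := ℝ)]
    have hΓ := Gamma_add_one_pos hα
    calc Real.Gamma (α + 1) * m ^ (k + 1) * (k + 1).factorial
        = (m * (k + 1)) * (Real.Gamma (α + 1) * m ^ k * k.factorial) := by
          rw [Nat.factorial_succ]
          push_cast
          ring
      _ ≤ (k + α + 1) * Real.Gamma (k + α + 1) := mul_le_mul hfactor ih (by positivity) hpos.le
      _ = Real.Gamma ((k + 1 : ℕ) + α + 1) := by
          rw [← Real.Gamma_add_one hpos.ne']
          push_cast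
          ring_nf

lemma exists_norm_besselClifford_term_le (hα : -1 < α) :
    ∃ m : ℝ, 0 < m ∧ ∀ u v w : ℝ, 0 ≤ u → 0 ≤ v → |w| ≤ m * (u * v) → ∀ k : ℕ,
      ‖w ^ k / (k.factorial * Real.Gamma (k + α + 1))‖ ≤
        (Real.Gamma (α + 1))⁻¹ * Real.exp v * (u ^ k / k.factorial) := by
  have hm : 0 < min 1 (1 + α) := lt_min one_pos (by linarith)
  refine ⟨min 1 (1 + α), hm, fun u v w hu hv hw k => ?_⟩
  set m := min 1 (1 + α)
  have hΓ := Gamma_add_one_pos hα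
  have hΓk := Gamma_natCast_add_add_one_pos hα k
  calc ‖w ^ k / (k.factorial * Real.Gamma (k + α + 1))‖
      = |w| ^ k / (k.factorial * Real.Gamma (k + α + 1)) := by
        rw [norm_div, norm_pow, Real.norm_eq_abs, Real.norm_of_nonneg (by positivity)]
    _ ≤ (m * (u * v)) ^ k / (k.factorial * (Real.Gamma (α + 1) * m ^ k * k.factorial)) := by
        gcongr
        exact Gamma_mul_pow_mul_factorial_le hα hm.le (min_le_left _ _) (min_le_right _ _) k
    _ = (Real.Gamma (α + 1))⁻¹ * (v ^ k / k.factorial) * (u ^ k / k.factorial) := by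
        rw [mul_pow, mul_pow]
        field_simp
    _ ≤ (Real.Gamma (α + 1))⁻¹ * Real.exp v * (u ^ k / k.factorial) := by
        gcongr
        exact Real.pow_div_factorial_le_exp v hv k

lemma summable_besselClifford (hα : -1 < α) (w : ℝ) :
    Summable fun k : ℕ => w ^ k / (k.factorial * Real.Gamma (k + α + 1)) := by
  obtain ⟨m, hm, hterm⟩ := exists_norm_besselClifford_term_le hα
  refine .of_norm_bounded ((Real.summable_pow_div_factorial (|w| / m)).mul_left _) fun k =>
    hterm (|w| / m) 1 w (by positivity) zero_le_one ?_ k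
  rw [mul_one, mul_div_cancel₀ _ hm.ne']

lemma hasSum_pow_div_factorial (u : ℝ) :
    HasSum (fun k : ℕ => u ^ k / k.factorial) (Real.exp u) := by
  rw [Real.exp_eq_exp_ℝ]
  exact NormedSpace.expSeries_div_hasSum_exp u

lemma exists_norm_besselClifford_le (hα : -1 < α) :
    ∃ m : ℝ, 0 < m ∧ ∀ u v w : ℝ, 0 ≤ u → 0 ≤ v → |w| ≤ m * (u * v) →
      ‖besselClifford α w‖ ≤ (Real.Gamma (α + 1))⁻¹ * Real.exp v * Real.exp u := by
  obtain ⟨m, hm, hterm⟩ := exists_norm_besselClifford_term_le hα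
  refine ⟨m, hm, fun u v w hu hv hw => ?_⟩
  exact tsum_of_norm_bounded ((hasSum_pow_div_factorial u).mul_left _) (hterm u v w hu hv hw)

lemma besselClifford_pos (hα : -1 < α) {w : ℝ} (hw : 0 ≤ w) : 0 < besselClifford α w := by
  refine (summable_besselClifford hα w).tsum_pos (fun k => ?_) 0 ?_
  · have := Gamma_natCast_add_add_one_pos hα k
    positivity
  · simpa using Gamma_add_one_pos hα

lemma measurable_besselClifford (hα : -1 < α) : Measurable (besselClifford α) := by
  refine measurable_of_tendsto_metrizable (f := fun n w => ∑ k ∈ Finset.range n,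
    w ^ k / (k.factorial * Real.Gamma (k + α + 1))) (fun n => by fun_prop) ?_
  exact tendsto_pi_nhds.2 fun w => (summable_besselClifford hα w).hasSum.tendsto_sum_nat

lemma integrable_gaussian_mul_besselClifford (hα : -1 < α) {a : ℝ} (ha : 0 < a) (s : ℝ) :
    Integrable (fun x => gaussian a x * besselClifford α (s * x ^ 2)) (besselMeasure α) := by
  obtain ⟨m, hm, hbound⟩ := exists_norm_besselClifford_le hα
  refine ((integrable_gaussian hα (half_pos ha)).const_mul
    ((Real.Gamma (α + 1))⁻¹ * Real.exp (2 * |s| / (m * a)))).mono'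
    ((continuous_gaussian a).measurable.mul ((measurable_besselClifford hα).comp
      (by fun_prop))).aestronglyMeasurable (.of_forall fun x => ?_)
  have hx := hbound (2 * |s| / (m * a)) (a / 2 * x ^ 2) (s * x ^ 2) (by positivity) (by positivity)
    (by rw [abs_mul, abs_of_nonneg (sq_nonneg x)]; exact le_of_eq (by field_simp))
  have hsplit : gaussian a x * Real.exp (a / 2 * x ^ 2) = gaussian (a / 2) x := by
    rw [gaussian, gaussian, ← Real.exp_add]
    ring_nf
  calc ‖gaussian a x * besselClifford α (s * x ^ 2)‖
      ≤ gaussian a x * ((Real.Gamma (α + 1))⁻¹ * Real.exp (a / 2 * x ^ 2) *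
          Real.exp (2 * |s| / (m * a))) := by
        rw [norm_mul, norm_gaussian]
        exact mul_le_mul_of_nonneg_left hx (gaussian_pos a x).le
    _ = (Real.Gamma (α + 1))⁻¹ * Real.exp (2 * |s| / (m * a)) * gaussian (a / 2) x := by
        rw [← hsplit]
        ring

lemma integral_besselClifford_term_mul_gaussian (hα : -1 < α) {a : ℝ} (ha : 0 < a) (s : ℝ)
    (k : ℕ) :
    ∫ x, s ^ k / (k.factorial * Real.Gamma (k + α + 1)) * (x ^ (2 * k) * gaussian a x)
      ∂(besselMeasure α) = 1 / 2 * a ^ (-α - 1) * ((s / a) ^ k / k.factorial) := by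
  have := (Gamma_natCast_add_add_one_pos hα k).ne'
  rw [integral_const_mul, integral_pow_mul_gaussian hα ha, div_pow]
  field_simp

lemma integral_gaussian_mul_besselClifford (hα : -1 < α) {a : ℝ} (ha : 0 < a) (s : ℝ) :
    ∫ x, gaussian a x * besselClifford α (s * x ^ 2) ∂(besselMeasure α) =
      1 / 2 * a ^ (-α - 1) * Real.exp (s / a) := by
  let term (k : ℕ) (x : ℝ) : ℝ :=
    s ^ k / (k.factorial * Real.Gamma (k + α + 1)) * (x ^ (2 * k) * gaussian a x)
  have hsum : Summable fun k => ∫ x, ‖term k x‖ ∂(besselMeasure α) := by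
    refine ((Real.summable_pow_div_factorial (|s| / a)).mul_left
      (1 / 2 * a ^ (-α - 1))).congr fun k => ?_
    rw [← integral_besselClifford_term_mul_gaussian hα ha]
    refine integral_congr_ae (.of_forall fun x => ?_)
    have hk := Gamma_natCast_add_add_one_pos hα k
    have hpow : 0 ≤ x ^ (2 * k) := (even_two_mul k).pow_nonneg x
    have hgauss := gaussian_pos a x
    simp only [term]
    rw [norm_mul, norm_div, norm_pow, Real.norm_eq_abs s, Real.norm_of_nonneg (by positivity),
      Real.norm_of_nonneg (by positivity)]
  have hswap := hasSum_integral_of_summable_integral_norm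
    (fun k => (integrable_pow_mul_gaussian hα ha k).const_mul _) hsum
  simp only [integral_besselClifford_term_mul_gaussian hα ha] at hswap
  rw [← hswap.unique ((hasSum_pow_div_factorial (s / a)).mul_left _)]
  refine integral_congr_ae (.of_forall fun x => ?_)
  simp only [besselClifford, mul_pow, ← pow_mul, ← tsum_mul_left]
  exact tsum_congr fun k => by ring

end BesselClifford

section HankelKernel

variable {𝕜 : Type*} [RCLike 𝕜] {α : ℝ}

lemma besselPsi_comm (α l x : ℝ) : besselPsi α l x = besselPsi α x l := by
  simp only [besselPsi, mul_comm]

lemma besselPsi_eq_besselClifford {l x : ℝ} (hl : 0 < l) (hx : 0 < x) :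
    besselPsi α l x = 2 ^ (-α) * besselClifford α (-(l ^ 2 / 4) * x ^ 2) := by
  have hxl : 0 < x * l := mul_pos hx hl
  rw [besselPsi, besselJ, ← mul_assoc, Real.div_rpow hxl.le two_pos.le, ← mul_div_assoc,
    ← Real.rpow_add hxl, neg_add_cancel, Real.rpow_zero, one_div, ← Real.rpow_neg two_pos.le]
  congr 1
  refine tsum_congr fun k => ?_
  rw [show -(l ^ 2 / 4) * x ^ 2 = (-1) * (x * l / 2) ^ 2 by ring, mul_pow, ← pow_mul]
  ring

lemma besselJ_eq_besselClifford (α z : ℝ) :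
    besselJ α z = (z / 2) ^ α * besselClifford α (-(z / 2) ^ 2) := by
  rw [besselJ, besselClifford]
  congr 1
  refine tsum_congr fun k => ?_
  rw [neg_pow ((z / 2) ^ 2), ← pow_mul]
  ring

lemma measurable_besselPsi (hα : -1 < α) : Measurable (Function.uncurry (besselPsi α)) := by
  have := measurable_besselClifford hα
  unfold Function.uncurry besselPsi
  simp only [besselJ_eq_besselClifford]
  fun_prop

lemma exists_norm_besselPsi_le (hα : -1 < α) {b : ℝ} (hb : 0 < b) :
    ∃ C A : ℝ, ∀ l x : ℝ, 0 < l → 0 < x →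
      ‖besselPsi α l x‖ ≤ C * (gaussian (-A) l * gaussian (-b) x) := by
  obtain ⟨m, hm, hbound⟩ := exists_norm_besselClifford_le hα
  refine ⟨2 ^ (-α) * (Real.Gamma (α + 1))⁻¹, 1 / (4 * m * b), fun l x hl hx => ?_⟩
  have hlx := hbound (b * x ^ 2) (1 / (4 * m * b) * l ^ 2) (-(l ^ 2 / 4) * x ^ 2) (by positivity)
    (by positivity) (by
      rw [neg_mul, abs_neg, abs_of_nonneg (by positivity)]
      exact le_of_eq (by field_simp))
  rw [besselPsi_eq_besselClifford hl hx, norm_mul, Real.norm_of_nonneg (by positivity), mul_assoc,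
    gaussian_neg, gaussian_neg, ← mul_assoc (Real.Gamma (α + 1))⁻¹]
  gcongr

lemma gaussian_mul_besselPsi (a : ℝ) {l x : ℝ} (hl : 0 < l) (hx : 0 < x) :
    gaussian a x * besselPsi α l x =
      2 ^ (-α) * (gaussian a x * besselClifford α (-(l ^ 2 / 4) * x ^ 2)) := by
  rw [besselPsi_eq_besselClifford hl hx, mul_left_comm]

lemma integrable_gaussian_mul_besselPsi (hα : -1 < α) {a : ℝ} (ha : 0 < a) {l : ℝ} (hl : 0 < l) :
    Integrable (fun x => gaussian a x * besselPsi α l x) (besselMeasure α) :=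
  ((integrable_gaussian_mul_besselClifford hα ha (-(l ^ 2 / 4))).const_mul (2 ^ (-α))).congr <|
    (ae_besselMeasure_pos α).mono fun _ hx => (gaussian_mul_besselPsi a hl hx).symm

lemma integral_gaussian_mul_besselPsi (hα : -1 < α) {a : ℝ} (ha : 0 < a) {l : ℝ} (hl : 0 < l) :
    ∫ x, gaussian a x * besselPsi α l x ∂(besselMeasure α) =
      (2 * a) ^ (-α - 1) * gaussian (1 / (4 * a)) l := by
  calc ∫ x, gaussian a x * besselPsi α l x ∂(besselMeasure α)
      = ∫ x, 2 ^ (-α) * (gaussian a x * besselClifford α (-(l ^ 2 / 4) * x ^ 2))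
          ∂(besselMeasure α) :=
        integral_congr_ae ((ae_besselMeasure_pos α).mono fun _ hx => gaussian_mul_besselPsi a hl hx)
    _ = 2 ^ (-α) * (1 / 2 * a ^ (-α - 1) * Real.exp (-(l ^ 2 / 4) / a)) := by
        rw [integral_const_mul, integral_gaussian_mul_besselClifford hα ha]
    _ = (2 * a) ^ (-α - 1) * gaussian (1 / (4 * a)) l := by
        rw [Real.mul_rpow two_pos.le ha.le, Real.rpow_sub_one two_ne_zero (-α), gaussian,
          show -(l ^ 2 / 4) / a = -(1 / (4 * a)) * l ^ 2 by field_simp]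
        ring

lemma eventually_integrable_prod_gaussian_smul_besselPsi_smul (hα : -1 < α) {b : ℝ} (hb : 0 < b)
    {g : ℝ → 𝕜} (hg : Integrable (fun x => gaussian (-b) x • g x) (besselMeasure α)) :
    ∀ᶠ a in atTop, Integrable (fun z : ℝ × ℝ => gaussian a z.1 • besselPsi α z.1 z.2 • g z.2)
      ((besselMeasure α).prod (besselMeasure α)) := by
  obtain ⟨C, A, hbound⟩ := exists_norm_besselPsi_le hα hb
  filter_upwards [eventually_ge_atTop (A + 1)] with a ha
  let φ (z : ℝ × ℝ) : ℝ := gaussian (a - 1) z.1 * besselPsi α z.1 z.2 * gaussian b z.2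
  have hφ_meas : Measurable φ :=
    (((continuous_gaussian _).measurable.comp measurable_fst).mul (measurable_besselPsi hα)).mul
      ((continuous_gaussian _).measurable.comp measurable_snd)
  have hφ_bound : ∀ᵐ z ∂(besselMeasure α).prod (besselMeasure α), ‖φ z‖ ≤ C := by
    filter_upwards [Measure.quasiMeasurePreserving_fst.ae (ae_besselMeasure_pos α),
      Measure.quasiMeasurePreserving_snd.ae (ae_besselMeasure_pos α)] with z h₁ h₂
    have hz := hbound z.1 z.2 h₁ h₂
    have hC : 0 ≤ C := nonneg_of_mul_nonneg_left ((norm_nonneg _).trans hz)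
      (mul_pos (gaussian_pos _ _) (gaussian_pos _ _))
    calc ‖φ z‖ = gaussian (a - 1) z.1 * gaussian b z.2 * ‖besselPsi α z.1 z.2‖ := by
          simp only [φ, norm_mul, norm_gaussian]
          ring
      _ ≤ gaussian (a - 1) z.1 * gaussian b z.2 *
            (C * (gaussian (-A) z.1 * gaussian (-b) z.2)) :=
          mul_le_mul_of_nonneg_left hz (mul_pos (gaussian_pos _ _) (gaussian_pos _ _)).le
      _ = C * gaussian (a - 1 + -A) z.1 := by
          rw [← gaussian_mul_gaussian]
          linear_combination C * gaussian (a - 1) z.1 * gaussian (-A) z.1 *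
            gaussian_mul_gaussian_neg b z.2
      _ ≤ C := mul_le_of_le_one_right hC (gaussian_le_one (by linarith) _)
  refine (((integrable_gaussian hα one_pos).smul_prod hg).bdd_smul C hφ_meas.aestronglyMeasurable
    hφ_bound).congr (.of_forall fun z => ?_)
  simp only [φ, Pi.smul_apply', smul_smul]
  congr 1
  rw [← sub_add_cancel a 1, ← gaussian_mul_gaussian (a - 1) 1, add_sub_cancel_right]
  linear_combination gaussian (a - 1) z.1 * gaussian 1 z.1 * besselPsi α z.1 z.2 *
    gaussian_mul_gaussian_neg b z.2

lemma eventually_integral_gaussian_smul_kernelOp_besselPsi (hα : -1 < α) {b : ℝ} (hb : 0 < b)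
    {g : ℝ → 𝕜} (hg : Integrable (fun x => gaussian (-b) x • g x) (besselMeasure α)) :
    ∀ᶠ a in atTop,
      Integrable (fun l => gaussian a l • kernelOp (besselMeasure α) (besselPsi α) g l)
        (besselMeasure α) ∧
      ∫ l, gaussian a l • kernelOp (besselMeasure α) (besselPsi α) g l ∂(besselMeasure α) =
        (2 * a) ^ (-α - 1) • ∫ x, gaussian (1 / (4 * a)) x • g x ∂(besselMeasure α) := by
  filter_upwards [eventually_integrable_prod_gaussian_smul_besselPsi_smul hα hb hg,
    eventually_gt_atTop 0] with a hint ha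
  simp only [kernelOp, ← integral_smul]
  refine ⟨hint.integral_prod_left, ?_⟩
  rw [integral_integral_swap hint]
  refine integral_congr_ae ((ae_besselMeasure_pos α).mono fun x hx => ?_)
  simp only [smul_smul, besselPsi_comm α _ x]
  rw [integral_smul_const, integral_gaussian_mul_besselPsi hα ha hx]

end HankelKernel

section HeatKernel

variable {α : ℝ}

/-- The Bessel heat kernel in closed form,
`(2t)⁻¹ (x y)^(-α) exp (-(x² + y²) / (4t)) I_α(x y / (2t))`. -/
def besselHeatKernel (α t x y : ℝ) : ℝ :=
  2 * (4 * t) ^ (-α - 1) * (gaussian (1 / (4 * t)) x * gaussian (1 / (4 * t)) y) *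
    besselClifford α ((x / (4 * t)) ^ 2 * y ^ 2)

lemma gaussian_mul_besselHeatKernel (α t a x y : ℝ) :
    gaussian a y * besselHeatKernel α t x y =
      2 * (4 * t) ^ (-α - 1) * gaussian (1 / (4 * t)) x *
        (gaussian (a + 1 / (4 * t)) y * besselClifford α ((x / (4 * t)) ^ 2 * y ^ 2)) := by
  rw [besselHeatKernel, ← gaussian_mul_gaussian]
  ring

lemma integrable_gaussian_mul_besselHeatKernel (hα : -1 < α) {t a : ℝ} (ht : 0 < t) (ha : 0 ≤ a)
    (x : ℝ) : Integrable (fun y => gaussian a y * besselHeatKernel α t x y) (besselMeasure α) := by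
  simp only [gaussian_mul_besselHeatKernel]
  exact (integrable_gaussian_mul_besselClifford hα (by positivity) _).const_mul _

lemma integral_gaussian_mul_besselHeatKernel (hα : -1 < α) {t a : ℝ} (ht : 0 < t) (ha : 0 ≤ a)
    (x : ℝ) :
    ∫ y, gaussian a y * besselHeatKernel α t x y ∂(besselMeasure α) =
      (1 + 4 * a * t) ^ (-α - 1) * gaussian (a / (1 + 4 * a * t)) x := by
  have hsum : 0 < 1 + 4 * a * t := by positivity
  have : 0 < (4 * t) ^ (-α - 1) := Real.rpow_pos_of_pos (by positivity) _
  have hexp : gaussian (a / (1 + 4 * a * t)) x = gaussian (1 / (4 * t)) x *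
      Real.exp ((x / (4 * t)) ^ 2 / (a + 1 / (4 * t))) := by
    rw [gaussian, gaussian, ← Real.exp_add]
    congr 1
    field_simp
    ring
  simp only [gaussian_mul_besselHeatKernel]
  rw [integral_const_mul, integral_gaussian_mul_besselClifford hα (by positivity), hexp,
    show a + 1 / (4 * t) = (1 + 4 * a * t) / (4 * t) by field_simp; ring,
    Real.div_rpow hsum.le (by positivity)]
  field_simp

lemma besselHeatKernel_symm (α t x y : ℝ) :
    besselHeatKernel α t x y = besselHeatKernel α t y x := by
  rw [besselHeatKernel, besselHeatKernel, mul_comm (gaussian _ x),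
    show (x / (4 * t)) ^ 2 * y ^ 2 = (y / (4 * t)) ^ 2 * x ^ 2 by ring]

lemma exists_besselHeatKernel_le (hα : -1 < α) {t : ℝ} (ht : 0 < t) (x : ℝ) :
    ∃ C, ∀ y, besselHeatKernel α t x y ≤ C := by
  obtain ⟨m, hm, hbound⟩ := exists_norm_besselClifford_le hα
  refine ⟨2 * (4 * t) ^ (-α - 1) * gaussian (1 / (4 * t)) x *
    ((Real.Gamma (α + 1))⁻¹ * Real.exp (x ^ 2 / (4 * t * m))), fun y => ?_⟩
  have hy := hbound (1 / (4 * t) * y ^ 2) (x ^ 2 / (4 * t * m)) ((x / (4 * t)) ^ 2 * y ^ 2)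
    (by positivity) (by positivity)
    (by rw [abs_of_nonneg (by positivity)]; exact le_of_eq (by field_simp))
  have hgauss := gaussian_pos (1 / (4 * t))
  calc besselHeatKernel α t x y
      ≤ 2 * (4 * t) ^ (-α - 1) * (gaussian (1 / (4 * t)) x * gaussian (1 / (4 * t)) y) *
          ((Real.Gamma (α + 1))⁻¹ * Real.exp (x ^ 2 / (4 * t * m)) *
            gaussian (-(1 / (4 * t))) y) := by
        rw [besselHeatKernel, gaussian_neg]
        have := hgauss x
        have := hgauss y
        gcongr
        exact (Real.le_norm_self _).trans hy
    _ = 2 * (4 * t) ^ (-α - 1) * gaussian (1 / (4 * t)) x *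
          ((Real.Gamma (α + 1))⁻¹ * Real.exp (x ^ 2 / (4 * t * m))) := by
        linear_combination 2 * (4 * t) ^ (-α - 1) * gaussian (1 / (4 * t)) x *
          ((Real.Gamma (α + 1))⁻¹ * Real.exp (x ^ 2 / (4 * t * m))) *
          gaussian_mul_gaussian_neg (1 / (4 * t)) y

lemma isSymmMarkovKernel_besselHeatKernel (hα : -1 < α) {t : ℝ} (ht : 0 < t) :
    IsSymmMarkovKernel (besselMeasure α) (besselHeatKernel α t) where
  measurable := by
    have := measurable_besselClifford hα
    have := (continuous_gaussian (1 / (4 * t))).measurable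
    unfold besselHeatKernel Function.uncurry
    fun_prop
  nonneg x y := by
    have := (besselClifford_pos hα (w := (x / (4 * t)) ^ 2 * y ^ 2) (by positivity)).le
    have := gaussian_pos (1 / (4 * t))
    unfold besselHeatKernel
    exact mul_nonneg (mul_nonneg (by positivity) (mul_pos (this x) (this y)).le) ‹_›
  symm := besselHeatKernel_symm α t
  bounded := exists_besselHeatKernel_le hα ht
  integral_eq_one x := by
    simpa [gaussian] using integral_gaussian_mul_besselHeatKernel hα ht le_rfl x

lemma kernelOp_besselHeatKernel_gaussian (hα : -1 < α) {t a : ℝ} (ht : 0 < t) (ha : 0 ≤ a)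
    (x : ℝ) :
    kernelOp (besselMeasure α) (besselHeatKernel α t) (gaussian a) x =
      (1 + 4 * a * t) ^ (-α - 1) * gaussian (a / (1 + 4 * a * t)) x := by
  simp only [kernelOp, smul_eq_mul, mul_comm (besselHeatKernel α t x _)]
  exact integral_gaussian_mul_besselHeatKernel hα ht ha x

lemma memL1AddLinf_gaussian (hα : -1 < α) {a : ℝ} (ha : 0 < a) :
    MemL1AddLinf (besselMeasure α) (gaussian a) :=
  .of_memLp le_rfl (memLp_one_iff_integrable.2 (integrable_gaussian hα ha))

lemma kernelComp_besselHeatKernel_ae_eq (hα : -1 < α) {s t : ℝ} (hs : 0 < s) (ht : 0 < t) (x : ℝ) :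
    kernelComp (besselMeasure α) (besselHeatKernel α s) (besselHeatKernel α t) x
      =ᵐ[besselMeasure α] besselHeatKernel α (s + t) x := by
  have hks := isSymmMarkovKernel_besselHeatKernel hα hs
  have hkt := isSymmMarkovKernel_besselHeatKernel hα ht
  have hst := add_pos hs ht
  refine ae_eq_of_eventually_integral_gaussian_smul_eq (ae_besselMeasure_pos α) ?_ ?_ ?_
  all_goals filter_upwards [eventually_gt_atTop 0] with a ha
  · simpa only [smul_eq_mul, mul_comm] using
      hks.integrable_kernelComp_smul hkt (memL1AddLinf_gaussian hα ha) x
  · exact integrable_gaussian_mul_besselHeatKernel hα hst ha.le x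
  have hevolve : kernelOp (besselMeasure α) (besselHeatKernel α t) (gaussian a) =
      (1 + 4 * a * t) ^ (-α - 1) • gaussian (a / (1 + 4 * a * t)) :=
    funext (kernelOp_besselHeatKernel_gaussian hα ht ha.le)
  calc ∫ y, gaussian a y * kernelComp _ (besselHeatKernel α s) (besselHeatKernel α t) x y ∂_
      = kernelOp _ (besselHeatKernel α s) (kernelOp _ (besselHeatKernel α t) (gaussian a)) x := by
        rw [← hks.kernelOp_kernelComp hkt (memL1AddLinf_gaussian hα ha) x]
        simp only [kernelOp, smul_eq_mul, mul_comm]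
    _ = (1 + 4 * a * (s + t)) ^ (-α - 1) * gaussian (a / (1 + 4 * a * (s + t))) x := by
        rw [hevolve, kernelOp_smul, Pi.smul_apply, smul_eq_mul,
          kernelOp_besselHeatKernel_gaussian hα hs (by positivity), ← mul_assoc,
          ← Real.mul_rpow (by positivity) (by positivity)]
        congr 2 <;> field_simp <;> ring
    _ = ∫ y, gaussian a y * besselHeatKernel α (s + t) x y ∂_ :=
        (integral_gaussian_mul_besselHeatKernel hα hst ha.le x).symm

end HeatKernel

section BesselKernel

variable {α : ℝ}

lemma besselKernel_eq_kernelOp_besselPsi (t : ℝ) {x y : ℝ} (hx : 0 < x) (hy : 0 < y) :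
    besselKernel α t x y =
      kernelOp (besselMeasure α) (besselPsi α) (fun l => gaussian t l * besselPsi α x l) y := by
  rw [besselKernel, besselKernel0, kernelOp, integral_besselMeasure, ← integral_const_mul]
  refine setIntegral_congr_fun measurableSet_Ioi fun l (hl : 0 < l) => ?_
  have hweight : ∀ u : ℝ, 0 < u → u ^ (-(α + 1 / 2)) * u ^ (1 / 2 : ℝ) = u ^ (-α) :=
      fun u hu => by
    rw [← Real.rpow_add hu]
    ring_nf
  have hdensity : l ^ (2 * α + 1) * (l ^ (-α) * l ^ (-α)) = l ^ (1 / 2 : ℝ) * l ^ (1 / 2 : ℝ) := by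
    rw [← Real.rpow_add hl, ← Real.rpow_add hl, ← Real.rpow_add hl]
    ring_nf
  simp only [besselPsi0, besselPsi, smul_eq_mul, Real.sqrt_eq_rpow, gaussian]
  rw [mul_comm l x, mul_comm l y, Real.mul_rpow hx.le hy.le, Real.mul_rpow hx.le hl.le,
    Real.mul_rpow hy.le hl.le, Real.mul_rpow hx.le hl.le, Real.mul_rpow hy.le hl.le,
    ← hweight x hx, ← hweight y hy]
  linear_combination -(x ^ (-(α + 1 / 2)) * x ^ (1 / 2 : ℝ) * y ^ (-(α + 1 / 2)) *
    y ^ (1 / 2 : ℝ) * Real.exp (-t * l ^ 2) * besselJ α (x * l) * besselJ α (y * l)) * hdensity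

/- Weber's second exponential integral, obtained by comparing the integrals of both sides against
Gaussians instead of expanding the product of two Bessel functions. -/
lemma besselKernel_ae_eq_besselHeatKernel (hα : -1 < α) {t : ℝ} (ht : 0 < t) {x : ℝ} (hx : 0 < x) :
    besselKernel α t x =ᵐ[besselMeasure α] besselHeatKernel α t x := by
  have hg : Integrable (fun l => gaussian (-(t / 2)) l • (gaussian t l * besselPsi α x l))
      (besselMeasure α) := by
    simp only [smul_eq_mul, ← mul_assoc, gaussian_mul_gaussian]
    exact integrable_gaussian_mul_besselPsi hα (by linarith) hx
  have hpair := eventually_integral_gaussian_smul_kernelOp_besselPsi hα (half_pos ht) hg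
  have hae : kernelOp (besselMeasure α) (besselPsi α) (fun l => gaussian t l * besselPsi α x l)
      =ᵐ[besselMeasure α] besselHeatKernel α t x := by
    refine ae_eq_of_eventually_integral_gaussian_smul_eq (ae_besselMeasure_pos α)
      (hpair.mono fun _ h => h.1) ?_ ?_
    all_goals filter_upwards [hpair, eventually_gt_atTop 0] with a hpair_a ha
    · exact integrable_gaussian_mul_besselHeatKernel hα ht ha.le x
    calc ∫ y, gaussian a y • kernelOp (besselMeasure α) (besselPsi α)
          (fun l => gaussian t l * besselPsi α x l) y ∂(besselMeasure α)
        = (2 * a) ^ (-α - 1) * ∫ l, gaussian (1 / (4 * a) + t) l * besselPsi α x l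
            ∂(besselMeasure α) := by
          rw [hpair_a.2]
          simp only [smul_eq_mul, ← mul_assoc, gaussian_mul_gaussian]
      _ = (1 + 4 * a * t) ^ (-α - 1) * gaussian (a / (1 + 4 * a * t)) x := by
          rw [integral_gaussian_mul_besselPsi hα (by positivity) hx, ← mul_assoc,
            ← Real.mul_rpow (by positivity) (by positivity)]
          congr 2
          · field_simp
            norm_num
          · field_simp
      _ = ∫ y, gaussian a y • besselHeatKernel α t x y ∂(besselMeasure α) :=
          (integral_gaussian_mul_besselHeatKernel hα ht ha.le x).symm
  filter_upwards [hae, ae_besselMeasure_pos α] with y hy hy_pos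
  rw [besselKernel_eq_kernelOp_besselPsi t hx hy_pos, hy]

end BesselKernel

section GramExtension

variable {𝕜 : Type*} [RCLike 𝕜] {ι E F : Type*} [NormedAddCommGroup E] [InnerProductSpace 𝕜 E]
  [NormedAddCommGroup F] [InnerProductSpace 𝕜 F]

lemma inner_linearCombination_eq {v : ι → E} {w : ι → F}
    (h : ∀ i j, inner 𝕜 (v i) (v j) = inner 𝕜 (w i) (w j)) (c d : ι →₀ 𝕜) :
    inner 𝕜 (Finsupp.linearCombination 𝕜 v c) (Finsupp.linearCombination 𝕜 v d) =
      inner 𝕜 (Finsupp.linearCombination 𝕜 w c) (Finsupp.linearCombination 𝕜 w d) := by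
  simp only [Finsupp.linearCombination_apply, Finsupp.sum_inner, Finsupp.inner_sum, inner_smul_left,
    inner_smul_right, h]

theorem exists_linearIsometry_of_inner_eq [CompleteSpace F] {v : ι → E} {w : ι → F}
    (hv : Dense (Submodule.span 𝕜 (range v) : Set E))
    (h : ∀ i j, inner 𝕜 (v i) (v j) = inner 𝕜 (w i) (w j)) :
    ∃ U : E →ₗᵢ[𝕜] F, ∀ i, U (v i) = w i := by
  let V := Finsupp.linearCombination 𝕜 v
  let W := Finsupp.linearCombination 𝕜 w
  have hV : DenseRange V := by
    rwa [DenseRange, ← LinearMap.coe_range, Finsupp.range_linearCombination]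
  have hnorm : ∀ c, ‖W c‖ = ‖V c‖ := fun c => by
    rw [@norm_eq_sqrt_re_inner 𝕜 F, @norm_eq_sqrt_re_inner 𝕜 E, inner_linearCombination_eq h]
  have hext : ∀ c, W.extendOfNorm V (V c) = W c :=
    LinearMap.extendOfNorm_eq hV ⟨1, fun c => by rw [one_mul, hnorm]⟩
  refine ⟨⟨W.extendOfNorm V, fun x => ?_⟩, fun i => ?_⟩
  · exact hV.induction_on (p := fun x => ‖W.extendOfNorm V x‖ = ‖x‖) x
      (isClosed_eq (by fun_prop) (by fun_prop)) fun c => by rw [hext, hnorm]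
  · simpa [V, W] using hext (Finsupp.single i 1)

end GramExtension

section DominatedConvergence

lemma tendsto_eLpNorm_smul_zero {X : Type*} [MeasurableSpace X] {μ : Measure X}
    {E : Type*} [NormedAddCommGroup E] [NormedSpace ℝ E] {ι : Type*} {l : Filter ι}
    [l.IsCountablyGenerated] {p : ℝ≥0∞} (hp0 : p ≠ 0) (hp_top : p ≠ ∞) {m : ι → X → ℝ} {f : X → E}
    (hf : MemLp f p μ) (hm : ∀ i, AEStronglyMeasurable (m i) μ) (hbound : ∀ i x, ‖m i x‖ ≤ 1)
    (hlim : ∀ᵐ x ∂μ, Tendsto (fun i => m i x) l (𝓝 0)) :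
    Tendsto (fun i => eLpNorm (fun x => m i x • f x) p μ) l (𝓝 0) := by
  have hp : 0 < p.toReal := ENNReal.toReal_pos hp0 hp_top
  have hlintegral : Tendsto (fun i => ∫⁻ x, ‖m i x • f x‖ₑ ^ p.toReal ∂μ) l (𝓝 0) := by
    rw [← lintegral_zero (μ := μ)]
    refine tendsto_lintegral_filter_of_dominated_convergence' (fun x => ‖f x‖ₑ ^ p.toReal)
      (.of_forall fun i => ((hm i).smul hf.1).enorm.pow_const _)
      (.of_forall fun i => .of_forall fun x => ?_)
      (lintegral_rpow_enorm_lt_top_of_eLpNorm_lt_top hp0 hp_top hf.2).ne ?_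
    · refine ENNReal.rpow_le_rpow (enorm_le_iff_norm_le.2 ?_) hp.le
      rw [norm_smul]
      exact mul_le_of_le_one_left (norm_nonneg _) (hbound i x)
    · filter_upwards [hlim] with x hx
      have hx_smul : Tendsto (fun i => m i x • f x) l (𝓝 0) := by
        simpa only [zero_smul] using hx.smul_const (f x)
      simpa [ENNReal.zero_rpow_of_pos hp] using hx_smul.enorm.ennrpow_const p.toReal
  simpa [eLpNorm_eq_lintegral_rpow_enorm_toReal hp0 hp_top, ENNReal.zero_rpow_of_pos, hp] using
    hlintegral.ennrpow_const (1 / p.toReal)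

end DominatedConvergence

section HankelL2

variable {𝕜 : Type*} [RCLike 𝕜] {α : ℝ}

lemma memLp_two_gaussian (hα : -1 < α) {a : ℝ} (ha : 0 < a) :
    MemLp (gaussian a) 2 (besselMeasure α) := by
  rw [memLp_two_iff_integrable_sq (continuous_gaussian a).aestronglyMeasurable]
  simpa only [sq, gaussian_mul_gaussian] using integrable_gaussian hα (add_pos ha ha)

lemma integrable_gaussian_smul (hα : -1 < α) {a : ℝ} (ha : 0 < a) {f : ℝ → 𝕜}
    (hf : MemLp f 2 (besselMeasure α)) :
    Integrable (fun x => gaussian a x • f x) (besselMeasure α) := by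
  have hmul : MemLp (gaussian a • f) 1 (besselMeasure α) := hf.smul (memLp_two_gaussian hα ha)
  exact memLp_one_iff_integrable.1 hmul

variable (𝕜) in
/-- The Gaussian `x ↦ exp (-a x²)` as an element of `L²(μ_α)`. -/
def gaussianLp (hα : -1 < α) {a : ℝ} (ha : 0 < a) : Lp 𝕜 2 (besselMeasure α) :=
  (memLp_two_gaussian hα ha).ofReal.toLp

lemma coeFn_gaussianLp (hα : -1 < α) {a : ℝ} (ha : 0 < a) :
    gaussianLp 𝕜 hα ha =ᵐ[besselMeasure α] fun x => (gaussian a x : 𝕜) :=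
  (memLp_two_gaussian hα ha).ofReal.coeFn_toLp

lemma inner_gaussianLp (hα : -1 < α) {a : ℝ} (ha : 0 < a) (f : Lp 𝕜 2 (besselMeasure α)) :
    inner 𝕜 (gaussianLp 𝕜 hα ha) f = ∫ x, gaussian a x • f x ∂(besselMeasure α) := by
  rw [L2.inner_def]
  refine integral_congr_ae ((coeFn_gaussianLp (𝕜 := 𝕜) hα ha).mono fun x hx => ?_)
  simp only [hx, RCLike.inner_apply', RCLike.conj_ofReal, RCLike.real_smul_eq_coe_mul]

lemma inner_gaussianLp_gaussianLp (hα : -1 < α) {a b : ℝ} (ha : 0 < a) (hb : 0 < b) :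
    inner 𝕜 (gaussianLp 𝕜 hα ha) (gaussianLp 𝕜 hα hb) =
      ((1 / 2 * (a + b) ^ (-α - 1) * Real.Gamma (α + 1) : ℝ) : 𝕜) := by
  rw [inner_gaussianLp, ← integral_gaussian_besselMeasure hα (add_pos ha hb), ← integral_ofReal]
  refine integral_congr_ae ((coeFn_gaussianLp (𝕜 := 𝕜) hα hb).mono fun x hx => ?_)
  simp only [hx, RCLike.real_smul_eq_coe_mul, ← RCLike.ofReal_mul, gaussian_mul_gaussian]

lemma Lp_ext_of_integral_gaussian_smul (hα : -1 < α) {F G : Lp 𝕜 2 (besselMeasure α)}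
    (h : ∀ a, 0 < a → ∫ x, gaussian a x • F x ∂(besselMeasure α) =
      ∫ x, gaussian a x • G x ∂(besselMeasure α)) : F = G := by
  have hpos := eventually_gt_atTop (0 : ℝ)
  exact Lp.ext <| ae_eq_of_eventually_integral_gaussian_smul_eq (ae_besselMeasure_pos α)
    (hpos.mono fun _ ha => integrable_gaussian_smul hα ha (Lp.memLp F))
    (hpos.mono fun _ ha => integrable_gaussian_smul hα ha (Lp.memLp G))
    (hpos.mono fun a ha => h a ha)

variable (𝕜) in
lemma dense_span_gaussianLp (hα : -1 < α) :
    Dense (Submodule.span 𝕜 (range fun a : Ioi (0 : ℝ) => gaussianLp 𝕜 hα a.2) :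
      Set (Lp 𝕜 2 (besselMeasure α))) := by
  rw [Submodule.dense_iff_topologicalClosure_eq_top, Submodule.topologicalClosure_eq_top_iff,
    Submodule.eq_bot_iff]
  refine fun f hf => Lp_ext_of_integral_gaussian_smul hα fun a ha => ?_
  rw [← inner_gaussianLp hα ha, ← inner_gaussianLp hα ha, inner_zero_right]
  exact (Submodule.mem_orthogonal _ f).1 hf _ (Submodule.subset_span ⟨⟨a, ha⟩, rfl⟩)

lemma inner_gaussianLp_dual (hα : -1 < α) {a b : ℝ} (ha : 0 < a) (hb : 0 < b) :
    inner 𝕜 (gaussianLp 𝕜 hα ha) (gaussianLp 𝕜 hα hb) =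
      inner 𝕜
        ((((2 * a) ^ (-α - 1) : ℝ) : 𝕜) • gaussianLp 𝕜 hα (a := 1 / (4 * a)) (by positivity))
        ((((2 * b) ^ (-α - 1) : ℝ) : 𝕜) • gaussianLp 𝕜 hα (a := 1 / (4 * b)) (by positivity)) := by
  have hsum : a + b = 2 * a * (2 * b * (1 / (4 * a) + 1 / (4 * b))) := by
    field_simp
    ring
  rw [inner_smul_left, inner_smul_right, RCLike.conj_ofReal, inner_gaussianLp_gaussianLp,
    inner_gaussianLp_gaussianLp, ← RCLike.ofReal_mul, ← RCLike.ofReal_mul, hsum,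
    Real.mul_rpow (x := 2 * a) (by positivity) (by positivity),
    Real.mul_rpow (x := 2 * b) (by positivity) (by positivity)]
  congr 1
  ring

lemma exists_linearIsometry_gaussianLp (hα : -1 < α) :
    ∃ U : Lp 𝕜 2 (besselMeasure α) →ₗᵢ[𝕜] Lp 𝕜 2 (besselMeasure α), ∀ a : Ioi (0 : ℝ),
      U (gaussianLp 𝕜 hα a.2) = (((2 * a) ^ (-α - 1) : ℝ) : 𝕜) •
        gaussianLp 𝕜 hα (a := 1 / (4 * a)) (one_div_pos.2 (mul_pos four_pos a.2)) :=
  exists_linearIsometry_of_inner_eq (dense_span_gaussianLp 𝕜 hα)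
    fun a b => inner_gaussianLp_dual hα a.2 b.2

variable (𝕜) in
/-- The Hankel transform `h_α` on `L²(μ_α)`, characterized by its values on Gaussians, which are
those of Weber's integral `integral_gaussian_mul_besselPsi`. -/
def hankelL2 (hα : -1 < α) : Lp 𝕜 2 (besselMeasure α) →ₗᵢ[𝕜] Lp 𝕜 2 (besselMeasure α) :=
  (exists_linearIsometry_gaussianLp hα).choose

lemma hankelL2_gaussianLp (hα : -1 < α) {a : ℝ} (ha : 0 < a) :
    hankelL2 𝕜 hα (gaussianLp 𝕜 hα ha) = (((2 * a) ^ (-α - 1) : ℝ) : 𝕜) •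
      gaussianLp 𝕜 hα (a := 1 / (4 * a)) (by positivity) :=
  (exists_linearIsometry_gaussianLp hα).choose_spec ⟨a, ha⟩

lemma hankelL2_hankelL2 (hα : -1 < α) (f : Lp 𝕜 2 (besselMeasure α)) :
    hankelL2 𝕜 hα (hankelL2 𝕜 hα f) = f := by
  let U := (hankelL2 𝕜 hα).toContinuousLinearMap
  suffices h : U.comp U = ContinuousLinearMap.id 𝕜 _ from DFunLike.congr_fun h f
  refine ContinuousLinearMap.ext_on (dense_span_gaussianLp 𝕜 hα) ?_
  rintro _ ⟨⟨a, ha : 0 < a⟩, rfl⟩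
  have hscale : 2 * a * (2 * (1 / (4 * a))) = 1 := by
    field_simp
    norm_num
  have hinv : 1 / (4 * (1 / (4 * a))) = a := by field_simp
  change hankelL2 𝕜 hα (hankelL2 𝕜 hα (gaussianLp 𝕜 hα ha)) = gaussianLp 𝕜 hα ha
  simp only [hankelL2_gaussianLp, map_smul, smul_smul, hinv]
  rw [← RCLike.ofReal_mul, ← Real.mul_rpow (by positivity) (by positivity), hscale, Real.one_rpow,
    RCLike.ofReal_one, one_smul]

lemma inner_hankelL2_comm (hα : -1 < α) (f g : Lp 𝕜 2 (besselMeasure α)) :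
    inner 𝕜 (hankelL2 𝕜 hα f) g = inner 𝕜 f (hankelL2 𝕜 hα g) := by
  rw [← (hankelL2 𝕜 hα).inner_map_map f, hankelL2_hankelL2]

lemma integral_gaussian_smul_hankelL2 (hα : -1 < α) {a : ℝ} (ha : 0 < a)
    (f : Lp 𝕜 2 (besselMeasure α)) :
    ∫ x, gaussian a x • hankelL2 𝕜 hα f x ∂(besselMeasure α) =
      (2 * a) ^ (-α - 1) • ∫ x, gaussian (1 / (4 * a)) x • f x ∂(besselMeasure α) := by
  rw [← inner_gaussianLp hα ha, ← inner_hankelL2_comm, hankelL2_gaussianLp, inner_smul_left,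
    RCLike.conj_ofReal, inner_gaussianLp, RCLike.real_smul_eq_coe_mul]

lemma kernelOp_besselPsi_ae_eq_hankelL2 (hα : -1 < α) {g : ℝ → 𝕜}
    (hg : MemLp g 2 (besselMeasure α)) {b : ℝ} (hb : 0 < b)
    (hgb : Integrable (fun x => gaussian (-b) x • g x) (besselMeasure α)) :
    kernelOp (besselMeasure α) (besselPsi α) g =ᵐ[besselMeasure α] hankelL2 𝕜 hα hg.toLp := by
  have hpair := eventually_integral_gaussian_smul_kernelOp_besselPsi hα hb hgb
  refine ae_eq_of_eventually_integral_gaussian_smul_eq (ae_besselMeasure_pos α)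
    (hpair.mono fun _ h => h.1) ?_ ?_
  all_goals filter_upwards [hpair, eventually_gt_atTop 0] with a hpair_a ha
  · exact integrable_gaussian_smul hα ha (Lp.memLp _)
  · rw [hpair_a.2, integral_gaussian_smul_hankelL2 hα ha]
    congr 1
    exact integral_congr_ae (hg.coeFn_toLp.mono fun x hx => by simp only [hx])

lemma integrable_gaussian_neg_smul_indicator (hα : -1 < α) {f : ℝ → 𝕜}
    (hf : MemLp f 2 (besselMeasure α)) {b : ℝ} (hb : 0 < b) (R : ℝ) :
    Integrable (fun x => gaussian (-b) x • (Ioc 0 R).indicator f x) (besselMeasure α) := by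
  let growth : ℝ → ℝ := (Ioc 0 R).indicator (gaussian (-(2 * b)))
  have hgrowth : Measurable growth :=
    (continuous_gaussian _).measurable.indicator measurableSet_Ioc
  have hgrowth_le : ∀ x, ‖growth x‖ ≤ gaussian (-(2 * b)) R := fun x => by
    unfold growth
    by_cases hx : x ∈ Ioc 0 R
    · rw [indicator_of_mem hx, norm_gaussian, gaussian_neg, gaussian_neg]
      gcongr
      exacts [hx.1.le, hx.2]
    · rw [indicator_of_notMem hx, norm_zero]
      exact (gaussian_pos _ _).le
  refine ((integrable_gaussian_smul hα hb hf).bdd_smul _ hgrowth.aestronglyMeasurable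
    (.of_forall hgrowth_le)).congr (.of_forall fun x => ?_)
  simp only [growth, Pi.smul_apply']
  by_cases hx : x ∈ Ioc 0 R
  · simp only [indicator_of_mem hx, smul_smul, gaussian_mul_gaussian]
    ring_nf
  · simp only [indicator_of_notMem hx, zero_smul, smul_zero]

lemma modHankelTrunc_eq_kernelOp (α R : ℝ) (f : ℝ → 𝕜) :
    modHankelTrunc α R f =
      kernelOp (besselMeasure α) (besselPsi α) ((Ioc 0 R).indicator f) := by
  ext l
  rw [modHankelTrunc, kernelOp, ← integral_indicator measurableSet_Ioc]
  simp only [indicator_smul_apply]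

lemma modHankelTrunc_ae_eq_hankelL2 (hα : -1 < α) {f : ℝ → 𝕜} (hf : MemLp f 2 (besselMeasure α))
    (R : ℝ) : modHankelTrunc α R f =ᵐ[besselMeasure α]
      hankelL2 𝕜 hα (hf.indicator (measurableSet_Ioc (a := 0) (b := R))).toLp := by
  rw [modHankelTrunc_eq_kernelOp]
  exact kernelOp_besselPsi_ae_eq_hankelL2 hα _ one_pos
    (integrable_gaussian_neg_smul_indicator hα hf one_pos R)

lemma eLpNorm_hankelL2_sub (hα : -1 < α) {f g : ℝ → 𝕜} (hf : MemLp f 2 (besselMeasure α))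
    (hg : MemLp g 2 (besselMeasure α)) :
    eLpNorm (hankelL2 𝕜 hα hf.toLp - hankelL2 𝕜 hα hg.toLp : ℝ → 𝕜) 2 (besselMeasure α) =
      eLpNorm (f - g) 2 (besselMeasure α) := by
  rw [← eLpNorm_congr_ae (Lp.coeFn_sub _ _), ← map_sub, ← Lp.enorm_def, LinearIsometry.enorm_map,
    ← MemLp.toLp_sub, Lp.enorm_toLp]

lemma tendsto_eLpNorm_indicator_Ioc_sub {f : ℝ → 𝕜} (hf : MemLp f 2 (besselMeasure α)) :
    Tendsto (fun R => eLpNorm ((Ioc 0 R).indicator f - f) 2 (besselMeasure α)) atTop (𝓝 0) := by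
  have htail : Tendsto (fun R => eLpNorm (fun x => (Ioc 0 R)ᶜ.indicator (fun _ => (1 : ℝ)) x • f x)
      2 (besselMeasure α)) atTop (𝓝 0) := by
    refine tendsto_eLpNorm_smul_zero two_ne_zero ENNReal.ofNat_ne_top hf (fun R =>
      (measurable_const.indicator measurableSet_Ioc.compl).aestronglyMeasurable) (fun R x => ?_) ?_
    · exact (norm_indicator_le_norm_self _ _).trans_eq norm_one
    · filter_upwards [ae_besselMeasure_pos α] with x hx
      refine tendsto_const_nhds.congr' ((eventually_ge_atTop x).mono fun R hR => ?_)
      exact (indicator_of_notMem (notMem_compl_iff.2 (mem_Ioc.2 ⟨hx, hR⟩)) _).symm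
  refine htail.congr fun R => ?_
  rw [eLpNorm_sub_comm]
  congr 1 with x
  rw [← indicator_smul_apply_left, indicator_compl]
  simp only [one_smul]

lemma isModHankel_hankelL2 (hα : -1 < α) {f : ℝ → 𝕜} (hf : MemLp f 2 (besselMeasure α)) :
    IsModHankel α f (hankelL2 𝕜 hα hf.toLp) := by
  refine ⟨Lp.memLp _, (tendsto_eLpNorm_indicator_Ioc_sub hf).congr fun R => ?_⟩
  rw [eLpNorm_congr_ae ((modHankelTrunc_ae_eq_hankelL2 hα hf R).sub .rfl), eLpNorm_hankelL2_sub]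

lemma isModHankel_modHankel (hα : -1 < α) {f : ℝ → 𝕜} (hf : MemLp f 2 (besselMeasure α)) :
    IsModHankel α f (modHankel α f) := by
  have h : ∃ g, IsModHankel α f g := ⟨_, isModHankel_hankelL2 hα hf⟩
  rw [modHankel, dif_pos h]
  exact h.choose_spec

lemma ae_eq_of_tendsto_eLpNorm_sub {X ι E : Type*} [MeasurableSpace X] {μ : Measure X}
    [NormedAddCommGroup E] {l : Filter ι} [l.NeBot] {p : ℝ≥0∞} (hp : 1 ≤ p) {u : ι → X → E}
    {g h : X → E} (hu : ∀ i, AEStronglyMeasurable (u i) μ) (hg : AEStronglyMeasurable g μ)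
    (hh : AEStronglyMeasurable h μ) (hug : Tendsto (fun i => eLpNorm (u i - g) p μ) l (𝓝 0))
    (huh : Tendsto (fun i => eLpNorm (u i - h) p μ) l (𝓝 0)) : g =ᵐ[μ] h := by
  have hzero : eLpNorm (g - h) p μ = 0 := by
    refine le_antisymm (ge_of_tendsto (by simpa using hug.add huh) (.of_forall fun i => ?_)) zero_le
    rw [eLpNorm_sub_comm _ g, ← sub_add_sub_cancel g (u i) h]
    exact eLpNorm_add_le (hg.sub (hu i)) ((hu i).sub hh) hp
  exact (sub_ae_eq_zero _ _).1
    ((eLpNorm_eq_zero_iff (hg.sub hh) (zero_lt_one.trans_le hp).ne').1 hzero)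

lemma modHankel_ae_eq_hankelL2 (hα : -1 < α) {f : ℝ → 𝕜} (hf : MemLp f 2 (besselMeasure α)) :
    modHankel α f =ᵐ[besselMeasure α] hankelL2 𝕜 hα hf.toLp := by
  obtain ⟨hmem, hlim⟩ := isModHankel_modHankel hα hf
  exact ae_eq_of_tendsto_eLpNorm_sub one_le_two
    (fun R => (Lp.aestronglyMeasurable _).congr (modHankelTrunc_ae_eq_hankelL2 hα hf R).symm)
    hmem.1 (Lp.aestronglyMeasurable _) hlim (isModHankel_hankelL2 hα hf).2

end HankelL2

section BesselHeat

variable {𝕜 : Type*} [RCLike 𝕜] {α : ℝ}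

lemma memLp_gaussian_smul {μ : Measure ℝ} {t : ℝ} (ht : 0 ≤ t) {p : ℝ≥0∞} {f : ℝ → 𝕜}
    (hf : MemLp f p μ) : MemLp (fun x => gaussian t x • f x) p μ :=
  hf.of_le ((continuous_gaussian t).aestronglyMeasurable.smul hf.1) <| .of_forall fun x => by
    rw [norm_smul, norm_gaussian]
    exact mul_le_of_le_one_left (norm_nonneg _) (gaussian_le_one ht x)

/-- The spectrally defined heat operator `f ↦ h_α (e^{-t l²} h_α f)` on `L²(μ_α)`. -/
def heatL2 (hα : -1 < α) (t : ℝ≥0) (f : Lp 𝕜 2 (besselMeasure α)) : Lp 𝕜 2 (besselMeasure α) :=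
  hankelL2 𝕜 hα (memLp_gaussian_smul t.coe_nonneg (Lp.memLp (hankelL2 𝕜 hα f))).toLp

lemma besselHeatL2_ae_eq_heatL2 (hα : -1 < α) (t : ℝ≥0) {f : ℝ → 𝕜}
    (hf : MemLp f 2 (besselMeasure α)) :
    besselHeatL2 α t f =ᵐ[besselMeasure α] heatL2 hα t hf.toLp := by
  have hmul : (fun l => Real.exp (-t * l ^ 2) • modHankel α f l) =ᵐ[besselMeasure α]
      fun l => gaussian t l • hankelL2 𝕜 hα hf.toLp l :=
    (modHankel_ae_eq_hankelL2 hα hf).mono fun l hl => by simp only [hl, gaussian]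
  have hmem := (memLp_gaussian_smul t.coe_nonneg (Lp.memLp (hankelL2 𝕜 hα hf.toLp))).ae_eq hmul.symm
  rw [heatL2, ← (MemLp.toLp_eq_toLp_iff hmem _).2 hmul]
  exact modHankel_ae_eq_hankelL2 hα hmem

lemma integral_gaussian_smul_heatL2 (hα : -1 < α) {a : ℝ} (ha : 0 < a) (t : ℝ≥0)
    (f : Lp 𝕜 2 (besselMeasure α)) :
    ∫ x, gaussian a x • heatL2 hα t f x ∂(besselMeasure α) =
      (1 + 4 * a * t) ^ (-α - 1) •
        ∫ x, gaussian (a / (1 + 4 * a * t)) x • f x ∂(besselMeasure α) := by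
  have hmul := memLp_gaussian_smul t.coe_nonneg (Lp.memLp (hankelL2 𝕜 hα f))
  have hparam : 1 / (4 * (1 / (4 * a) + t)) = a / (1 + 4 * a * t) := by field_simp
  have hscale : 2 * a * (2 * (1 / (4 * a) + t)) = 1 + 4 * a * t := by
    field_simp
    ring
  calc ∫ x, gaussian a x • heatL2 hα t f x ∂(besselMeasure α)
      = (2 * a) ^ (-α - 1) • ∫ l, gaussian (1 / (4 * a) + t) l • hankelL2 𝕜 hα f l
          ∂(besselMeasure α) := by
        rw [heatL2, integral_gaussian_smul_hankelL2 hα ha]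
        congr 1
        refine integral_congr_ae (hmul.coeFn_toLp.mono fun l hl => ?_)
        simp only [hl, smul_smul, ← gaussian_mul_gaussian]
    _ = (1 + 4 * a * t) ^ (-α - 1) •
          ∫ x, gaussian (a / (1 + 4 * a * t)) x • f x ∂(besselMeasure α) := by
        rw [integral_gaussian_smul_hankelL2 hα (by positivity), smul_smul,
          ← Real.mul_rpow (by positivity) (by positivity), hparam, hscale]

lemma integral_gaussian_smul_kernelOp_besselHeatKernel (hα : -1 < α) {a t : ℝ} (ha : 0 < a)
    (ht : 0 < t) {f : ℝ → 𝕜} (hf : MemLp f 2 (besselMeasure α)) :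
    ∫ x, gaussian a x • kernelOp (besselMeasure α) (besselHeatKernel α t) f x ∂(besselMeasure α) =
      (1 + 4 * a * t) ^ (-α - 1) •
        ∫ x, gaussian (a / (1 + 4 * a * t)) x • f x ∂(besselMeasure α) := by
  have hgauss : MemLp (fun x => (gaussian a x : 𝕜)) 2 (besselMeasure α) :=
    (memLp_two_gaussian hα ha).ofReal
  have hinner := (isSymmMarkovKernel_besselHeatKernel hα ht).integral_inner_kernelOp hgauss hf
  have hheat : ∀ x, kernelOp (besselMeasure α) (besselHeatKernel α t)
      (fun y => (gaussian a y : 𝕜)) x =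
        (((1 + 4 * a * t) ^ (-α - 1) * gaussian (a / (1 + 4 * a * t)) x : ℝ) : 𝕜) := fun x => by
    rw [← kernelOp_besselHeatKernel_gaussian hα ht ha.le, kernelOp, kernelOp, ← integral_ofReal]
    simp only [RCLike.real_smul_eq_coe_mul, RCLike.ofReal_mul, smul_eq_mul]
  simp only [hheat, RCLike.inner_apply', RCLike.conj_ofReal, ← RCLike.real_smul_eq_coe_mul,
    mul_smul, integral_smul] at hinner
  exact hinner.symm

lemma kernelOp_besselHeatKernel_ae_eq_heatL2 (hα : -1 < α) {t : ℝ≥0} (ht : 0 < t) {f : ℝ → 𝕜}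
    (hf : MemLp f 2 (besselMeasure α)) :
    kernelOp (besselMeasure α) (besselHeatKernel α t) f =ᵐ[besselMeasure α]
      heatL2 hα t hf.toLp := by
  have ht_coe := NNReal.coe_pos.2 ht
  have hK := (isSymmMarkovKernel_besselHeatKernel hα ht_coe).memLp_kernelOp one_le_two hf
  suffices h : hK.toLp = heatL2 hα t hf.toLp from h ▸ hK.coeFn_toLp.symm
  refine Lp_ext_of_integral_gaussian_smul hα fun a ha => ?_
  have hcoe {u : ℝ → 𝕜} (hu : MemLp u 2 (besselMeasure α)) (b : ℝ) :
      ∫ x, gaussian b x • hu.toLp u x ∂(besselMeasure α) =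
        ∫ x, gaussian b x • u x ∂(besselMeasure α) :=
    integral_congr_ae (hu.coeFn_toLp.mono fun x hx => by simp only [hx])
  rw [hcoe hK, integral_gaussian_smul_heatL2 hα ha, hcoe hf,
    integral_gaussian_smul_kernelOp_besselHeatKernel hα ha ht_coe hf]

lemma besselHeat_zero (α : ℝ) (f : ℝ → 𝕜) : besselHeat α 0 f = f := if_pos rfl

lemma besselHeat_ae_eq_kernelOp (hα : -1 < α) {t : ℝ≥0} (ht : 0 < t) (f : ℝ → 𝕜) :
    besselHeat α t f =ᵐ[besselMeasure α]
      kernelOp (besselMeasure α) (besselHeatKernel α t) f := by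
  filter_upwards [ae_besselMeasure_pos α] with x hx
  rw [besselHeat, if_neg ht.ne']
  exact kernelOp_congr_kernel_ae
    (besselKernel_ae_eq_besselHeatKernel hα (NNReal.coe_pos.2 ht) hx) f

lemma besselHeat_congr_ae (t : ℝ≥0) {f g : ℝ → 𝕜} (h : f =ᵐ[besselMeasure α] g) :
    besselHeat α t f =ᵐ[besselMeasure α] besselHeat α t g := by
  unfold besselHeat
  split_ifs
  · exact h
  · exact (kernelOp_congr_ae h).eventuallyEq

lemma integrable_besselKernel_smul (hα : -1 < α) {t : ℝ} (ht : 0 < t) {f : ℝ → 𝕜}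
    (hf : MemL1AddLinf (besselMeasure α) f) {x : ℝ} (hx : 0 < x) :
    Integrable (fun y => besselKernel α t x y • f y) (besselMeasure α) :=
  ((isSymmMarkovKernel_besselHeatKernel hα ht).integrable_smul hf x).congr <|
    (besselKernel_ae_eq_besselHeatKernel hα ht hx).mono fun y hy => by simp only [hy]

lemma heatL2_zero (hα : -1 < α) (f : Lp 𝕜 2 (besselMeasure α)) : heatL2 hα 0 f = f := by
  have hone : (fun l => gaussian (0 : ℝ≥0) l • hankelL2 𝕜 hα f l) = hankelL2 𝕜 hα f := by
    ext l
    simp [gaussian]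
  simp only [heatL2, hone, Lp.toLp_coeFn, hankelL2_hankelL2]

lemma besselHeat_ae_eq_heatL2 (hα : -1 < α) (t : ℝ≥0) {f : ℝ → 𝕜}
    (hf : MemLp f 2 (besselMeasure α)) :
    besselHeat α t f =ᵐ[besselMeasure α] heatL2 hα t hf.toLp := by
  rcases eq_zero_or_pos t with rfl | ht
  · rw [besselHeat_zero, heatL2_zero]
    exact hf.coeFn_toLp.symm
  · exact (besselHeat_ae_eq_kernelOp hα ht f).trans
      (kernelOp_besselHeatKernel_ae_eq_heatL2 hα ht hf)

lemma besselHeat_ae_eq_besselHeatL2 (hα : -1 < α) (t : ℝ≥0) {f : ℝ → 𝕜}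
    (hf : MemLp f 2 (besselMeasure α)) :
    besselHeat α t f =ᵐ[besselMeasure α] besselHeatL2 α t f :=
  (besselHeat_ae_eq_heatL2 hα t hf).trans (besselHeatL2_ae_eq_heatL2 hα t hf).symm

lemma tendsto_eLpNorm_gaussian_smul_sub {μ : Measure ℝ} {p : ℝ≥0∞} (hp0 : p ≠ 0) (hp_top : p ≠ ∞)
    {f : ℝ → 𝕜} (hf : MemLp f p μ) :
    Tendsto (fun t : ℝ≥0 => eLpNorm ((fun x => gaussian t x • f x) - f) p μ) (𝓝[>] 0) (𝓝 0) := by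
  refine (tendsto_eLpNorm_smul_zero (m := fun (t : ℝ≥0) x => gaussian t x - 1) hp0 hp_top hf
    (fun t => ((continuous_gaussian t).sub continuous_const).aestronglyMeasurable)
    (fun t x => ?_) (.of_forall fun x => ?_)).congr fun t => ?_
  · rw [Real.norm_eq_abs, abs_le]
    constructor <;> linarith [gaussian_pos t x, gaussian_le_one t.coe_nonneg x]
  · have hcont : Continuous fun t : ℝ≥0 => gaussian t x - 1 := by
      unfold gaussian
      fun_prop
    simpa [gaussian] using (hcont.tendsto 0).mono_left nhdsWithin_le_nhds
  · congr 1 with x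
    simp only [sub_smul, one_smul, Pi.sub_apply]

lemma tendsto_eLpNorm_besselHeat_sub (hα : -1 < α) {f : ℝ → 𝕜}
    (hf : MemLp f 2 (besselMeasure α)) :
    Tendsto (fun t : ℝ≥0 => eLpNorm (besselHeat α t f - f) 2 (besselMeasure α)) (𝓝[>] 0)
      (𝓝 0) := by
  have hF := Lp.memLp (hankelL2 𝕜 hα hf.toLp)
  refine (tendsto_eLpNorm_gaussian_smul_sub two_ne_zero ENNReal.ofNat_ne_top hF).congr fun t => ?_
  have hf_eq : hankelL2 𝕜 hα hF.toLp =ᵐ[besselMeasure α] f := by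
    rw [Lp.toLp_coeFn, hankelL2_hankelL2]
    exact hf.coeFn_toLp
  rw [← eLpNorm_hankelL2_sub hα (memLp_gaussian_smul t.coe_nonneg hF) hF]
  exact eLpNorm_congr_ae ((besselHeat_ae_eq_heatL2 hα t hf).sub hf_eq.symm).symm

lemma isSymmMarkovOperator_besselHeat (hα : -1 < α) (t : ℝ≥0) :
    IsSymmMarkovOperator (besselMeasure α) (besselHeat α t : (ℝ → 𝕜) → (ℝ → 𝕜)) := by
  rcases eq_zero_or_pos t with rfl | ht
  · exact (IsSymmMarkovOperator.id _).congr fun f => (besselHeat_zero α f).eventuallyEq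
  · have hK := isSymmMarkovKernel_besselHeatKernel hα (NNReal.coe_pos.2 ht)
    exact hK.isSymmMarkovOperator_kernelOp.congr (besselHeat_ae_eq_kernelOp hα ht)

lemma besselHeat_add_time (hα : -1 < α) (s t : ℝ≥0) {f : ℝ → 𝕜}
    (hf : MemL1AddLinf (besselMeasure α) f) :
    besselHeat α (s + t) f =ᵐ[besselMeasure α] besselHeat α s (besselHeat α t f) := by
  rcases eq_zero_or_pos s with rfl | hs
  · rw [zero_add, besselHeat_zero]
  rcases eq_zero_or_pos t with rfl | ht
  · rw [add_zero, besselHeat_zero]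
  have hs_coe := NNReal.coe_pos.2 hs
  have ht_coe := NNReal.coe_pos.2 ht
  have hcomp : kernelOp (besselMeasure α) (besselHeatKernel α (s + t)) f =
      kernelOp (besselMeasure α) (besselHeatKernel α s)
        (kernelOp (besselMeasure α) (besselHeatKernel α t) f) := by
    ext x
    rw [← (isSymmMarkovKernel_besselHeatKernel hα hs_coe).kernelOp_kernelComp
      (isSymmMarkovKernel_besselHeatKernel hα ht_coe) hf]
    exact kernelOp_congr_kernel_ae
      (kernelComp_besselHeatKernel_ae_eq hα hs_coe ht_coe x).symm f
  calc besselHeat α (s + t) f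
      =ᵐ[besselMeasure α] kernelOp (besselMeasure α) (besselHeatKernel α (s + t)) f :=
        besselHeat_ae_eq_kernelOp hα (add_pos hs ht) f
    _ =ᵐ[besselMeasure α] besselHeat α s
          (kernelOp (besselMeasure α) (besselHeatKernel α t) f) :=
        hcomp ▸ (besselHeat_ae_eq_kernelOp hα hs _).symm
    _ =ᵐ[besselMeasure α] besselHeat α s (besselHeat α t f) :=
        besselHeat_congr_ae s (besselHeat_ae_eq_kernelOp hα ht f).symm

theorem isMarkovianSymmetricDiffusionSemigroup_besselHeat (hα : -1 < α) :
    IsMarkovianSymmetricDiffusionSemigroup (besselMeasure α)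
      (besselHeat α : ℝ≥0 → (ℝ → 𝕜) → (ℝ → 𝕜)) where
  congr_ae t := (isSymmMarkovOperator_besselHeat hα t).congr_ae
  aestronglyMeasurable t := (isSymmMarkovOperator_besselHeat hα t).aestronglyMeasurable
  map_add t := (isSymmMarkovOperator_besselHeat hα t).map_add
  map_smul t := (isSymmMarkovOperator_besselHeat hα t).map_smul
  map_zero_time f _ := (besselHeat_zero α f).eventuallyEq
  contraction t := (isSymmMarkovOperator_besselHeat hα t).contraction
  semigroup s t _ hp _ hf := besselHeat_add_time hα s t (.of_memLp hp hf)
  selfAdjoint t := (isSymmMarkovOperator_besselHeat hα t).selfAdjoint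
  tendsto_zero _ hf := tendsto_eLpNorm_besselHeat_sub hα hf
  nonneg t := (isSymmMarkovOperator_besselHeat hα t).nonneg
  conservative t := (isSymmMarkovOperator_besselHeat hα t).conservative

end BesselHeat

end

/-- For `α > -1`, the Hankel transform `h_α` is well defined on `L²(μ_α)`; the heat kernel
integrals converge on `L¹ + L^∞` and extend the spectrally defined semigroup on `L²(μ_α)`; and
the resulting family is a Markovian symmetric diffusion semigroup. -/
theorem mainTheorem9 {𝕜 : Type*} [RCLike 𝕜] (α : ℝ) (hα : -1 < α) :
    (∀ f : ℝ → 𝕜, MemLp f 2 (besselMeasure α) → IsModHankel α f (modHankel α f)) ∧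
    (∀ t : ℝ≥0, 0 < t → ∀ f : ℝ → 𝕜, MemL1AddLinf (besselMeasure α) f → ∀ x : ℝ, 0 < x →
      Integrable (fun y => besselKernel α t x y • f y) (besselMeasure α)) ∧
    (∀ (t : ℝ≥0) (f : ℝ → 𝕜), MemLp f 2 (besselMeasure α) →
      besselHeat α t f =ᵐ[besselMeasure α] besselHeatL2 α t f) ∧
    IsMarkovianSymmetricDiffusionSemigroup (besselMeasure α)
      (besselHeat α : ℝ≥0 → (ℝ → 𝕜) → (ℝ → 𝕜)) :=
  ⟨fun _ hf => isModHankel_modHankel hα hf,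
    fun _ ht _ hf _ hx => integrable_besselKernel_smul hα (NNReal.coe_pos.2 ht) hf hx,
    fun t _ hf => besselHeat_ae_eq_besselHeatL2 hα t hf,
    isMarkovianSymmetricDiffusionSemigroup_besselHeat hα⟩
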